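/- Let $\mathcal O$ be the ring of all algebraic integers in $\overline{\mathbb Q}$, let $A$ be a square root of $-1$, and let $\mathbb Z[A]\to\mathbb Z[A]/(1+A)=\mathbb F_2$ be reduction modulo $1+A$. Put $$H'_5(T)=T^2\pm 3A\,T-25,\qquad H'_7(T)=T^2-5T+7^2,\qquad H'_{13}(T)=T^2+10T+13^2,$$ where the sign in $H'_5$ is either one of the two (fixed arbitrarily); the reductions modulo $1+A$ are $T^2+T+1$, $T^2+T+1$ and $T^2+1$. Up to isomorphism (conjugation in $\mathrm{GL}_2(\mathbb F_2)$) there is exactly one continuous representation $\rho:\mathrm{Gal}(\overline{\mathbb Q}/\mathbb Q)\to \mathrm{GL}_2(\mathbb F_2)$ such that $\rho$ is unramified at every prime $p\neq 2,3$ (the inertia group of every prime of $\mathcal O$ above $p$ lies in $\ker\rho$) and, for $p=5,7,13$, the characteristic polynomial of $\rho(\mathrm{Frob}_p)$ is $H'_p(T)$ modulo $1+A$ (for every Frobenius element at every prime of $\mathcal O$ above $p$). Moreover $\rho$ is surjective, and $\ker\rho=\mathrm{Gal}(\overline{\mathbb Q}/K_6)$, where $K_6\subset\overline{\mathbb Q}$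 is the splitting field of $x^3+3x-2$ over $\mathbb Q$. -/

import Mathlib

open Polynomial NumberField

noncomputable section

/-- `Gal(ℚ̄/ℚ)`, with Mathlib's Krull topology. -/
abbrev GQ : Type := Gal(AlgebraicClosure ℚ/ℚ)

/-- Continuous two-dimensional representations `Gal(ℚ̄/ℚ) → GL₂(𝔽₂)`; the target is discrete. -/
abbrev GQRep : Type := GQ →ₜ* GL (Fin 2) (ZMod 2)

/-- Isomorphism of representations: conjugacy by an element of `GL₂(𝔽₂)`. -/
def GQRep.Isomorphic (ρ ρ' : GQRep) : Prop :=
  ∃ g : GL (Fin 2) (ZMod 2), ∀ σ : GQ, ρ' σ = g * ρ σ * g⁻¹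

/-- `ρ` is unramified at `p`: the inertia group of every prime of the ring of all algebraic
integers above `p` acts trivially. -/
def GQRep.UnramifiedAt (ρ : GQRep) (p : ℕ) : Prop :=
  ∀ P : Ideal (𝓞 (AlgebraicClosure ℚ)), P.IsPrime → P.LiesOver (Ideal.span {(p : ℤ)}) →
    ∀ σ ∈ P.inertia GQ, ρ σ = 1

/-- The characteristic polynomial of `ρ(Frob_p)` is `f`: this is asked for every (arithmetic)
Frobenius element at every prime of the ring of all algebraic integers above `p`. -/
def GQRep.FrobCharpoly (ρ : GQRep) (p : ℕ) (f : (ZMod 2)[X]) : Prop :=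
  ∀ P : Ideal (𝓞 (AlgebraicClosure ℚ)), P.IsPrime → P.LiesOver (Ideal.span {(p : ℤ)}) →
    ∀ σ : GQ, IsArithFrobAt ℤ σ P → (ρ σ : Matrix (Fin 2) (Fin 2) (ZMod 2)).charpoly = f

/-- The element `A` of `ℤ[A] = ℤ[i]`, with `A² = -1`. -/
def gaussA : GaussianInt := ⟨0, 1⟩

/-- Reduction modulo `1 + A`, as a map `ℤ[A] → 𝔽₂` (it sends `A` to `-1 = 1`). -/
def redModOneAddA : GaussianInt →+* ZMod 2 :=
  Zsqrtd.lift ⟨1, by decide⟩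

theorem redModOneAddA_surjective : Function.Surjective redModOneAddA :=
  ZMod.ringHom_surjective _

theorem ker_redModOneAddA : RingHom.ker redModOneAddA = Ideal.span {1 + gaussA} := by
  ext z
  rw [RingHom.mem_ker, Ideal.mem_span_singleton]
  constructor
  · intro h
    have h' : ((z.re + z.im : ℤ) : ZMod 2) = 0 := by
      simpa [redModOneAddA, Zsqrtd.lift] using h
    rw [ZMod.intCast_zmod_eq_zero_iff_dvd] at h'
    obtain ⟨k, hk⟩ := h'
    refine ⟨⟨k, z.im - k⟩, ?_⟩
    push_cast at hk
    ext
    · simp [gaussA]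
      linarith
    · simp [gaussA]
  · rintro ⟨w, rfl⟩
    have : redModOneAddA (1 + gaussA) = 0 := by
      simp [redModOneAddA, Zsqrtd.lift, gaussA]
      decide
    rw [map_mul, this, zero_mul]

/-- `H'₅(T) = T² ± 3A T - 25`, where the sign `±` is `ε`. -/
def tableH5 (ε : ℤˣ) : GaussianInt[X] :=
  X ^ 2 + C (((ε : ℤ) : GaussianInt) * 3 * gaussA) * X - 25

/-- `H'₇(T) = T² - 5 T + 7²`. -/
def tableH7 : GaussianInt[X] := X ^ 2 - 5 * X + 7 ^ 2

/-- `H'₁₃(T) = T² + 10 T + 13²`. -/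
def tableH13 : GaussianInt[X] := X ^ 2 + 10 * X + 13 ^ 2

/-- `ρ` is unramified outside `2` and `3`, and for `p = 5, 7, 13` the characteristic polynomial of
`ρ(Frob_p)` is `H'_p` reduced modulo `1 + A`. -/
structure GQRep.MatchesTable (ρ : GQRep) (ε : ℤˣ) : Prop where
  unramified : ∀ p : ℕ, p.Prime → p ≠ 2 → p ≠ 3 → ρ.UnramifiedAt p
  frob5 : ρ.FrobCharpoly 5 ((tableH5 ε).map redModOneAddA)
  frob7 : ρ.FrobCharpoly 7 (tableH7.map redModOneAddA)
  frob13 : ρ.FrobCharpoly 13 (tableH13.map redModOneAddA)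

/-- The splitting field of `x³ + 3x - 2` inside `ℚ̄`. -/
def K6 : IntermediateField ℚ (AlgebraicClosure ℚ) :=
  IntermediateField.adjoin ℚ
    ((X ^ 3 + 3 * X - 2 : ℚ[X]).rootSet (AlgebraicClosure ℚ))

end

/-!
`GL₂(𝔽₂)` is the symmetric group of the three nonzero vectors of the plane (`glPerm`), and the
characteristic polynomial of an element is `T² + T + 1` when it has no fixed vector, `T² + 1`
when it has one. So the theorem is about homomorphisms from `Gal(ℚ̄/ℚ)` to `S₃` that are
unramified outside `6`, send Frobenius elements at `5` and `7` to three-cycles and those at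
`13` to elements with a fixed point.

*Existence.* `Gal(ℚ̄/ℚ)` permutes the roots of `x³ + 3x - 2`, a polynomial of discriminant
`-216` without roots modulo `5` and `7` and with the root `9` modulo `13`
(`exists_matchesTable`).

*Uniqueness.* Such a homomorphism is transitive, so it is the action on three conjugate numbers
`θᵢ` (`exists_equivariant`). The square root of their discriminant generates `ℚ(√d)` with `d`
squarefree; `d` divides `6` by unramifiedness, and `5` and `7` do not stay prime in `ℚ(√d)`,
whence `d = 1` or `d = -6`. Both cases are handled by explicit Kummer theory with the Lagrange
resolvent `β = θ₀ + ω θ₁ + ω² θ₂`. After scaling, `β³` lies in `ℤ[ω]` if `d = 1` and in `ℤ[√2]`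
if `d = -6`, as `√-6 √-3` is a rational multiple of `√2`. Both are principal ideal domains with
one prime above each of `2` and `3`. Unramifiedness makes the exponents in `β³` of the primes
not above `6` divisible by `3` (`dvd_of_map_eq_pow_of_inertia_le`), and since the norm of `β³`
is the cube of an integer this holds for the primes above `2` and `3` as well. So `β³` is a
unit times a cube.

For `d = 1` the unit is a root of unity, the cubic field would be the one inside the field of ninth
roots of unity, and this contradicts the condition at `13` (`not_forall_sign_eq_one`). For
`d = -6` the unit is `±(1 + √2)ᵐ`, and Cardano's formula for `x³ + 3x - 2` shows that the field cut
out by the homomorphism lies in `K6` (`fixingSubgroup_K6_le_ker`). By surjectivity all matching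
representations have the same kernel, namely that of the representation just constructed; they
then differ by an automorphism of `GL₂(𝔽₂)`, which is inner (`gl_mulAut_inner`).

Unramifiedness is given through inertia groups in `Gal(ℚ̄/ℚ)`, and the Frobenius conditions
through primes of the ring of all algebraic integers. The passage to finite extensions rests on
the surjectivity of inertia groups (`exists_mem_inertia_restrictNormalHom_eq`) and the
existence of Frobenius elements (`exists_isArithFrobAt`).
-/

open scoped Pointwise

local notation "Ω" => AlgebraicClosure ℚ

/-! ### The group `GL₂(𝔽₂)` as a symmetric group -/

/-- The nonzero vectors of `𝔽₂²`. -/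
abbrev NonzeroVec : Type := {v : Fin 2 → ZMod 2 // v ≠ 0}

/-- The action of `GL₂(𝔽₂)` on the nonzero vectors of the plane. -/
instance : MulAction (GL (Fin 2) (ZMod 2)) NonzeroVec where
  smul g v := ⟨g.val.mulVec v, fun h => v.2 <| by
    have := congrArg (g⁻¹.val.mulVec) h
    rwa [Matrix.mulVec_mulVec, Units.inv_mul, Matrix.one_mulVec, Matrix.mulVec_zero] at this⟩
  one_smul v := Subtype.ext (Matrix.one_mulVec v.1)
  mul_smul g h v := Subtype.ext (Matrix.mulVec_mulVec v.1 g.val h.val).symm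

theorem card_nonzeroVec : Fintype.card NonzeroVec = 3 := by decide

set_option synthInstance.maxSize 1000 in
set_option synthInstance.maxHeartbeats 200000 in
theorem matrix_charpoly_dichotomy : ∀ g : Matrix (Fin 2) (Fin 2) (ZMod 2), g.det ≠ 0 →
    (g.det = 1) ∧ (g.trace = 1 ↔ ∀ v : Fin 2 → ZMod 2, v ≠ 0 → g.mulVec v ≠ v) ∧
    (g.trace = 0 ↔ ∃ v : Fin 2 → ZMod 2, v ≠ 0 ∧ g.mulVec v = v) := by
  decide

theorem matrix_eq_one_of_fix : ∀ g : Matrix (Fin 2) (Fin 2) (ZMod 2),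
    (∀ v : Fin 2 → ZMod 2, v ≠ 0 → g.mulVec v = v) → g = 1 := by
  decide

theorem charpoly_eq_add_add_iff (g : GL (Fin 2) (ZMod 2)) :
    (g : Matrix (Fin 2) (Fin 2) (ZMod 2)).charpoly = X ^ 2 + X + 1 ↔
      ∀ v : NonzeroVec, g • v ≠ v := by
  have hd : g.val.det ≠ 0 := ((Matrix.isUnit_iff_isUnit_det _).1 g.isUnit).ne_zero
  obtain ⟨h1, h2, h3⟩ := matrix_charpoly_dichotomy g.val hd
  rw [Matrix.charpoly_fin_two, h1]
  constructor
  · intro h v hv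
    refine h2.1 ?_ v.1 v.2 (congrArg Subtype.val hv)
    have := congrArg (fun p => p.coeff 1) h
    simpa [coeff_X, coeff_one, ZModModule.neg_eq_self] using this
  · intro h
    rw [h2.2 fun v hv hv' => h ⟨v, hv⟩ (Subtype.ext hv')]
    have : (-1 : (ZMod 2)[X]) = 1 := by rw [← C_1, ← C_neg]; congr 1
    simp only [map_one, one_mul]
    linear_combination (X : (ZMod 2)[X]) * this

theorem charpoly_eq_add_iff (g : GL (Fin 2) (ZMod 2)) :
    (g : Matrix (Fin 2) (Fin 2) (ZMod 2)).charpoly = X ^ 2 + 1 ↔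
      ∃ v : NonzeroVec, g • v = v := by
  have hd : g.val.det ≠ 0 := ((Matrix.isUnit_iff_isUnit_det _).1 g.isUnit).ne_zero
  obtain ⟨h1, h2, h3⟩ := matrix_charpoly_dichotomy g.val hd
  rw [Matrix.charpoly_fin_two, h1]
  constructor
  · intro h
    obtain ⟨v, hv, hv'⟩ := h3.1 (by
      have := congrArg (fun p => p.coeff 1) h
      simpa [coeff_X, coeff_one, ZModModule.neg_eq_self] using this)
    exact ⟨⟨v, hv⟩, Subtype.ext hv'⟩
  · rintro ⟨v, hv⟩
    rw [h3.2 ⟨v.1, v.2, congrArg Subtype.val hv⟩]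
    simp

theorem toPermHom_injective :
    Function.Injective (MulAction.toPermHom (GL (Fin 2) (ZMod 2)) NonzeroVec) := by
  rw [injective_iff_map_eq_one]
  intro g hg
  refine Units.ext (matrix_eq_one_of_fix _ fun v hv => ?_)
  exact congrArg Subtype.val (Equiv.ext_iff.1 hg ⟨v, hv⟩)

theorem toPermHom_bijective :
    Function.Bijective (MulAction.toPermHom (GL (Fin 2) (ZMod 2)) NonzeroVec) := by
  refine (Nat.bijective_iff_injective_and_card _).2 ⟨toPermHom_injective, ?_⟩
  rw [Matrix.card_GL_field, Nat.card_eq_fintype_card, Fintype.card_perm, card_nonzeroVec]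
  simp [Fin.prod_univ_two]
  decide

/-- The isomorphism `GL₂(𝔽₂) ≃ S₃` given by the action on the three nonzero vectors. -/
noncomputable def glPerm : GL (Fin 2) (ZMod 2) ≃* Equiv.Perm (Fin 3) :=
  (MulEquiv.ofBijective _ toPermHom_bijective).trans
    (Equiv.permCongrHom (Fintype.equivFinOfCardEq card_nonzeroVec))

theorem charpoly_eq_add_add_iff_glPerm (g : GL (Fin 2) (ZMod 2)) :
    (g : Matrix (Fin 2) (Fin 2) (ZMod 2)).charpoly = X ^ 2 + X + 1 ↔
      ∀ i, glPerm g i ≠ i := by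
  rw [charpoly_eq_add_add_iff,
    (Fintype.equivFinOfCardEq card_nonzeroVec).symm.forall_congr_left]
  simp [glPerm, Equiv.permCongrHom, Equiv.permCongr, Equiv.equivCongr, eq_comm]

theorem charpoly_eq_add_iff_glPerm (g : GL (Fin 2) (ZMod 2)) :
    (g : Matrix (Fin 2) (Fin 2) (ZMod 2)).charpoly = X ^ 2 + 1 ↔
      ∃ i, glPerm g i = i := by
  rw [charpoly_eq_add_iff,
    (Fintype.equivFinOfCardEq card_nonzeroVec).symm.exists_congr_left]
  simp [glPerm, Equiv.permCongrHom, Equiv.permCongr, Equiv.equivCongr]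

set_option synthInstance.maxSize 1000 in
set_option synthInstance.maxHeartbeats 200000 in
theorem perm3_conj : ∀ a b : Equiv.Perm (Fin 3), a ^ 3 = 1 → a ≠ 1 → b ^ 2 = 1 → b ≠ 1 →
    ∃ g, g * finRotate 3 * g⁻¹ = a ∧ g * Equiv.swap 0 1 * g⁻¹ = b := by
  decide

theorem perm3_eq_pow_mul_pow : ∀ x : Equiv.Perm (Fin 3), ∃ i j : Fin 3,
    x = finRotate 3 ^ i.val * Equiv.swap 0 1 ^ j.val := by
  decide

theorem perm3_mulAut_inner (ψ : Equiv.Perm (Fin 3) ≃* Equiv.Perm (Fin 3)) :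
    ∃ g, ∀ x, ψ x = g * x * g⁻¹ := by
  obtain ⟨g, h1, h2⟩ := perm3_conj (ψ (finRotate 3)) (ψ (Equiv.swap 0 1))
    (by rw [← map_pow, ← map_one ψ]; congr 1; decide)
    (by rw [Ne, EmbeddingLike.map_eq_one_iff]; decide)
    (by rw [← map_pow, ← map_one ψ]; congr 1; decide)
    (by rw [Ne, EmbeddingLike.map_eq_one_iff]; decide)
  refine ⟨g, fun x => ?_⟩
  obtain ⟨i, j, rfl⟩ := perm3_eq_pow_mul_pow x
  rw [map_mul, map_pow, map_pow, ← h1, ← h2, conj_pow, conj_pow]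
  group

/-- Every automorphism of `GL₂(𝔽₂)` is inner. -/
theorem gl_mulAut_inner (ψ : GL (Fin 2) (ZMod 2) ≃* GL (Fin 2) (ZMod 2)) :
    ∃ g, ∀ x, ψ x = g * x * g⁻¹ := by
  obtain ⟨g, hg⟩ := perm3_mulAut_inner ((glPerm.symm.trans ψ).trans glPerm)
  refine ⟨glPerm.symm g, fun x => glPerm.injective ?_⟩
  simpa using hg (glPerm x)

/-! ### Frobenius elements and inertia groups in the ring of all algebraic integers -/

/-- The `ℚ`-algebra structure that instance search finds on `ℚ̄` is the one of a field of
characteristic zero, which is not definitionally the one for which Mathlib records that `ℚ̄` is an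
algebraic closure; hence the restatement. -/
instance isAlgClosure_rat_algebraicClosure : IsAlgClosure ℚ Ω := by
  have h := AlgebraicClosure.instIsAlgClosure ℚ
  convert! h

instance isGalois_rat_algebraicClosure : IsGalois ℚ Ω :=
  have : Algebra.IsAlgebraic ℚ Ω := IsAlgClosure.isAlgebraic
  { to_isSeparable := Algebra.IsAlgebraic.isSeparable_of_perfectField
    to_normal := IsAlgClosure.normal _ _ }

instance isAlgebraic_rat_algebraicClosure : Algebra.IsAlgebraic ℚ Ω := IsAlgClosure.isAlgebraic

@[simp]
theorem coe_smul_ringOfIntegers {K : Type} [Field K] [Algebra K Ω] (σ : Gal(Ω/K)) (x : 𝓞 Ω) :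
    algebraMap (𝓞 Ω) Ω (σ • x) = σ (algebraMap (𝓞 Ω) Ω x) := rfl

/-- The Galois group of `ℚ̄/K` acts on all algebraic integers, the fixed ring being the ring of
integers of `K`. -/
theorem isInvariant_ringOfIntegers {K A : Type} [Field K] [Algebra K Ω] [IsGalois K Ω]
    [CommRing A] [Algebra A K] [IsIntegralClosure A ℤ K] [Algebra A (𝓞 Ω)]
    (h : ∀ a : A, algebraMap (𝓞 Ω) Ω (algebraMap A (𝓞 Ω) a) = algebraMap K Ω (algebraMap A K a)) :
    Algebra.IsInvariant A (𝓞 Ω) Gal(Ω/K) where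
  isInvariant x hx := by
    obtain ⟨y, hy⟩ := (InfiniteGalois.mem_range_algebraMap_iff_fixed (k := K) (x : Ω)).2
      fun σ => congrArg Subtype.val (hx σ)
    have hy' : IsIntegral ℤ y := by
      have : IsIntegral ℤ (x : Ω) := x.isIntegral_coe
      rw [← hy] at this
      exact (isIntegral_algHom_iff ((algebraMap K Ω).toIntAlgHom) (algebraMap K Ω).injective).1 this
    obtain ⟨a, rfl⟩ := (IsIntegralClosure.isIntegral_iff (A := A)).1 hy'
    exact ⟨a, RingOfIntegers.ext ((h a).trans hy)⟩

theorem smulCommClass_ringOfIntegers {K A : Type} [Field K] [Algebra K Ω]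
    [CommRing A] [Algebra A K] [Algebra A (𝓞 Ω)]
    (h : ∀ a : A, algebraMap (𝓞 Ω) Ω (algebraMap A (𝓞 Ω) a) = algebraMap K Ω (algebraMap A K a)) :
    SMulCommClass Gal(Ω/K) A (𝓞 Ω) where
  smul_comm σ a x := by
    refine RingOfIntegers.coe_injective ?_
    rw [Algebra.smul_def, Algebra.smul_def, coe_smul_ringOfIntegers, map_mul, map_mul, map_mul, h,
      AlgEquiv.commutes, coe_smul_ringOfIntegers]

theorem continuousSMul_ringOfIntegers {K : Type} [Field K] [Algebra K Ω] [IsGalois K Ω]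
    [TopologicalSpace (𝓞 Ω)] [DiscreteTopology (𝓞 Ω)] :
    ContinuousSMul Gal(Ω/K) (𝓞 Ω) := by
  refine continuousSMul_iff_stabilizer_isOpen.2 fun x => ?_
  convert! stabilizer_isOpen_of_isIntegral (K := K) (x : Ω)
  ext σ
  exact RingOfIntegers.ext_iff

theorem isInvariant_int : Algebra.IsInvariant ℤ (𝓞 Ω) GQ :=
  isInvariant_ringOfIntegers (K := ℚ) (by simp)

theorem natCast_mem_of_liesOver {R : Type*} [CommRing R] {p : ℕ} {P : Ideal R}
    [P.LiesOver (Ideal.span {(p : ℤ)})] : (p : R) ∈ P := by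
  have : (p : ℤ) ∈ P.under ℤ := by
    rw [← Ideal.over_def P (Ideal.span {(p : ℤ)})]
    exact Ideal.mem_span_singleton_self _
  simpa [Ideal.under] using this

theorem intCast_mem_iff_of_liesOver {R : Type*} [CommRing R] {p : ℕ} {P : Ideal R}
    [P.LiesOver (Ideal.span {(p : ℤ)})] (n : ℤ) : (n : R) ∈ P ↔ (p : ℤ) ∣ n := by
  rw [← Ideal.mem_span_singleton, Ideal.over_def P (Ideal.span {(p : ℤ)})]
  simp [Ideal.under]

theorem exists_liesOver (p : ℕ) [Fact p.Prime] :
    ∃ P : Ideal (𝓞 Ω), P.IsPrime ∧ P.LiesOver (Ideal.span {(p : ℤ)}) := by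
  have : (Ideal.span {(p : ℤ)}).IsPrime :=
    (Ideal.span_singleton_prime (by exact_mod_cast (Fact.out : p.Prime).ne_zero)).2
      (Nat.prime_iff_prime_int.1 Fact.out)
  obtain ⟨⟨P, hP⟩⟩ := (inferInstance : Nonempty ((Ideal.span {(p : ℤ)}).primesOver (𝓞 Ω)))
  exact ⟨P, hP⟩

theorem isArithFrobAt_iff {p : ℕ} {P : Ideal (𝓞 Ω)}
    [P.LiesOver (Ideal.span {(p : ℤ)})] {σ : GQ} :
    IsArithFrobAt ℤ σ P ↔ ∀ x : 𝓞 Ω, σ • x - x ^ p ∈ P := by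
  have h : Nat.card (ℤ ⧸ P.under ℤ) = p := by
    rw [← Ideal.over_def P (Ideal.span {(p : ℤ)}), Int.card_ideal_quot]
  rw [IsArithFrobAt, AlgHom.IsArithFrobAt, h]
  rfl

/-- The absolute Galois group has a Frobenius element at every prime of the ring of all algebraic
integers: the decomposition group surjects onto the automorphisms of the residue field, also for
infinite extensions. -/
theorem exists_isArithFrobAt {p : ℕ} [Fact p.Prime] (P : Ideal (𝓞 Ω)) [P.IsPrime]
    [P.LiesOver (Ideal.span {(p : ℤ)})] : ∃ σ : GQ, IsArithFrobAt ℤ σ P := by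
  let _ : TopologicalSpace (𝓞 Ω) := ⊥
  have : DiscreteTopology (𝓞 Ω) := ⟨rfl⟩
  have := continuousSMul_ringOfIntegers (K := ℚ)
  have := isInvariant_int
  have : P.IsMaximal := by
    have : (Ideal.span {(p : ℤ)}).IsMaximal := Int.ideal_span_isMaximal_of_prime p
    exact Ideal.IsMaximal.of_liesOver_isMaximal P (Ideal.span {(p : ℤ)})
  let _ : Field (𝓞 Ω ⧸ P) := Ideal.Quotient.field P
  have : CharP (𝓞 Ω ⧸ P) p := by
    refine (CharP.charP_iff_prime_eq_zero Fact.out).2 ?_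
    rw [← map_natCast (Ideal.Quotient.mk P), Ideal.Quotient.eq_zero_iff_mem]
    exact natCast_mem_of_liesOver
  -- The residue field is perfect, as every algebraic integer has an integral `p`-th root.
  have : PerfectRing (𝓞 Ω ⧸ P) p := by
    refine PerfectRing.ofSurjective _ p fun x => ?_
    obtain ⟨x, rfl⟩ := Ideal.Quotient.mk_surjective x
    obtain ⟨y, hy⟩ := IsAlgClosed.exists_pow_nat_eq (x : Ω) (Fact.out : p.Prime).pos
    have hy' : IsIntegral ℤ y := .of_pow (Fact.out : p.Prime).pos (hy ▸ x.isIntegral_coe)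
    refine ⟨Ideal.Quotient.mk P ⟨y, hy'⟩, ?_⟩
    rw [frobenius_def]
    refine (map_pow (Ideal.Quotient.mk P) _ p).symm.trans ?_
    exact congrArg _ (RingOfIntegers.ext hy)
  let l : (𝓞 Ω ⧸ P) ≃ₐ[ℤ ⧸ Ideal.span {(p : ℤ)}] 𝓞 Ω ⧸ P :=
    { __ := frobeniusEquiv (𝓞 Ω ⧸ P) p
      commutes' r := by
        obtain ⟨r, rfl⟩ := Ideal.Quotient.mk_surjective r
        simp }
  obtain ⟨σ, hσ⟩ := Ideal.Quotient.stabilizerHom_surjective_of_profinite (G := GQ)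
    (Ideal.span {(p : ℤ)}) P l
  refine ⟨σ, (isArithFrobAt_iff (p := p)).2 fun x ↦ ?_⟩
  rw [← Ideal.Quotient.eq]
  exact DFunLike.congr_fun hσ (Ideal.Quotient.mk P x)

/-- Inertia groups surject onto inertia groups in a quotient of the absolute Galois group. An
extension of `τ` to `ℚ̄` is first corrected by `Gal(ℚ̄/M)` to preserve `P`, then to act trivially on
the residue field of `P`. -/
theorem exists_mem_inertia_restrictNormalHom_eq (M : IntermediateField ℚ Ω) [Normal ℚ M]
    (P : Ideal (𝓞 Ω)) [P.IsPrime] (τ : Gal(M/ℚ))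
    (hτ : τ ∈ (P.under (𝓞 M)).inertia Gal(M/ℚ)) :
    ∃ σ ∈ P.inertia GQ, AlgEquiv.restrictNormalHom M σ = τ := by
  let _ : TopologicalSpace (𝓞 Ω) := ⊥
  have : DiscreteTopology (𝓞 Ω) := ⟨rfl⟩
  have := continuousSMul_ringOfIntegers (K := M)
  have : Algebra.IsInvariant (𝓞 M) (𝓞 Ω) Gal(Ω/M) := isInvariant_ringOfIntegers fun _ => rfl
  have : SMulCommClass Gal(Ω/M) (𝓞 M) (𝓞 Ω) := smulCommClass_ringOfIntegers fun _ => rfl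
  obtain ⟨σ₀, rfl⟩ := AlgEquiv.restrictNormalHom_surjective Ω τ
  have hcomm (m : 𝓞 M) : algebraMap (𝓞 M) (𝓞 Ω) (AlgEquiv.restrictNormalHom M σ₀ • m) =
      σ₀ • algebraMap (𝓞 M) (𝓞 Ω) m :=
    RingOfIntegers.coe_injective (AlgEquiv.restrictNormal_commutes σ₀ M m)
  -- `σ₀` need not preserve `P`, but `σ₀ • P` and `P` lie over the same prime of `M`.
  have hunder : (σ₀ • P).under (𝓞 M) = P.under (𝓞 M) := by
    ext m
    -- The restriction of `σ₀` to `M` lies in the inertia group, hence preserves the prime of `M`.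
    have h1 : m - (AlgEquiv.restrictNormalHom M σ₀)⁻¹ • m ∈ P.under (𝓞 M) := by
      simpa using hτ ((AlgEquiv.restrictNormalHom M σ₀)⁻¹ • m)
    have h2 : m ∈ (σ₀ • P).under (𝓞 M) ↔
        (AlgEquiv.restrictNormalHom M σ₀)⁻¹ • m ∈ P.under (𝓞 M) := by
      simp only [Ideal.under, Ideal.mem_comap]
      rw [Ideal.mem_pointwise_smul_iff_inv_smul_mem, ← map_inv,
        show algebraMap (𝓞 M) (𝓞 Ω) (AlgEquiv.restrictNormalHom M σ₀⁻¹ • m) =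
          σ₀⁻¹ • algebraMap (𝓞 M) (𝓞 Ω) m from
        RingOfIntegers.coe_injective (AlgEquiv.restrictNormal_commutes σ₀⁻¹ M m)]
    rw [h2]
    exact ⟨fun h => by simpa using add_mem h1 h, fun h => by simpa using sub_mem h h1⟩
  obtain ⟨g, hg⟩ := Algebra.IsInvariant.exists_smul_of_under_eq_of_profinite (A := 𝓞 M)
    (G := Gal(Ω/M)) (σ₀ • P) P hunder
  let g' : GQ := g.restrictScalars ℚ
  let σ₁ : GQ := g' * σ₀
  have hσ₁ : P = σ₁ • P := by
    rw [mul_smul]; exact hg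
  have hσ₁m (m : 𝓞 M) : σ₁ • algebraMap (𝓞 M) (𝓞 Ω) m - algebraMap (𝓞 M) (𝓞 Ω) m ∈ P := by
    have h1 : σ₁ • algebraMap (𝓞 M) (𝓞 Ω) m =
        algebraMap (𝓞 M) (𝓞 Ω) (AlgEquiv.restrictNormalHom M σ₀ • m) := by
      rw [mul_smul, ← hcomm]
      exact RingOfIntegers.coe_injective (g.commutes _)
    rw [h1, ← map_sub]
    exact hτ m
  let e := Ideal.quotientEquiv P P (MulSemiringAction.toRingEquiv GQ (𝓞 Ω) σ₁) hσ₁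
  let l : (𝓞 Ω ⧸ P) ≃ₐ[𝓞 M ⧸ P.under (𝓞 M)] 𝓞 Ω ⧸ P :=
    { __ := e
      commutes' r := by
        obtain ⟨r, rfl⟩ := Ideal.Quotient.mk_surjective r
        exact Ideal.Quotient.eq.2 (hσ₁m r) }
  obtain ⟨h, hh⟩ := Ideal.Quotient.stabilizerHom_surjective_of_profinite (G := Gal(Ω/M))
    (P.under (𝓞 M)) P l
  have hh' (x : 𝓞 Ω) : h.1 • x - σ₁ • x ∈ P := Ideal.Quotient.eq.1 <|
    DFunLike.congr_fun hh (Ideal.Quotient.mk P x)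
  let h' : GQ := h.1.restrictScalars ℚ
  refine ⟨h'⁻¹ * σ₁, fun x => ?_, ?_⟩
  · have h1 : h'⁻¹ • P = P := by
      rw [inv_smul_eq_iff]
      exact h.2.symm
    have h2 := Ideal.smul_mem_pointwise_smul h'⁻¹ _ _ (hh' x)
    rw [h1, smul_sub] at h2
    have h3 : h'⁻¹ • h.1 • x = x := inv_smul_smul h' x
    rw [h3] at h2
    rw [mul_smul, ← neg_sub]
    exact neg_mem h2
  · have key (f : Gal(Ω/M)) : AlgEquiv.restrictNormalHom M (f.restrictScalars ℚ) = 1 := by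
      ext m
      exact (AlgEquiv.restrictNormal_commutes (f.restrictScalars ℚ) M m).trans (f.commutes m)
    rw [map_mul, map_inv, map_mul, key, key, inv_one, one_mul, one_mul]

/-- A rational prime is unramified in a finite Galois extension `M/ℚ` inside `ℚ̄` if the absolute
inertia groups above it fix `M`. -/
theorem natCast_notMem_sq (M : IntermediateField ℚ Ω) [IsGalois ℚ M] [FiniteDimensional ℚ M]
    {p : ℕ} [Fact p.Prime] (hM : ∀ P : Ideal (𝓞 Ω), P.IsPrime →
      P.LiesOver (Ideal.span {(p : ℤ)}) → P.inertia GQ ≤ M.fixingSubgroup)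
    (𝔭 : Ideal (𝓞 M)) [𝔭.IsPrime] [𝔭.LiesOver (Ideal.span {(p : ℤ)})] : (p : 𝓞 M) ∉ 𝔭 ^ 2 := by
  have : NumberField M := ⟨⟩
  have : (Ideal.span {(p : ℤ)}).IsMaximal := Int.ideal_span_isMaximal_of_prime p
  obtain ⟨⟨P, hP, hP'⟩⟩ := (inferInstance : Nonempty (𝔭.primesOver (𝓞 Ω)))
  have hPp : P.LiesOver (Ideal.span {(p : ℤ)}) := Ideal.LiesOver.trans P 𝔭 _
  have hbot : 𝔭.inertia Gal(M/ℚ) = ⊥ := by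
    refine (Subgroup.eq_bot_iff_forall _).2 fun τ hτ => ?_
    rw [hP'.over] at hτ
    obtain ⟨σ, hσ, rfl⟩ := exists_mem_inertia_restrictNormalHom_eq M P τ hτ
    ext m
    exact (AlgEquiv.restrictNormal_commutes σ M m).trans (hM P hP hPp hσ m)
  have h := Ideal.card_inertia_eq_ramificationIdxIn (G := Gal(M/ℚ)) (Ideal.span {(p : ℤ)}) 𝔭
  rw [hbot, Ideal.ramificationIdxIn_eq_ramificationIdx (Ideal.span {(p : ℤ)}) 𝔭 Gal(M/ℚ),
    Ideal.IsDedekindDomain.ramificationIdx_eq_multiplicity (Ideal.span {(p : ℤ)})] at h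
  · intro hp
    rw [Ideal.map_span, Set.image_singleton, eq_intCast, Int.cast_natCast] at h
    have hdvd : 𝔭 ^ 2 ∣ Ideal.span {(p : 𝓞 M)} :=
      Ideal.dvd_iff_le.2 ((Ideal.span_singleton_le_iff_mem _).2 hp)
    have hfin : FiniteMultiplicity 𝔭 (Ideal.span {(p : 𝓞 M)}) := by
      refine FiniteMultiplicity.of_prime_left (Ideal.prime_of_isPrime ?_ inferInstance) ?_
      · rintro rfl
        have := natCast_mem_of_liesOver (R := 𝓞 M) (p := p) (P := ⊥)
        simp [(Fact.out : p.Prime).ne_zero] at this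
      · simp [(Fact.out : p.Prime).ne_zero]
    have := hfin.le_multiplicity_of_pow_dvd hdvd
    simp [← h] at this
  · simp [Ideal.map_span, (Fact.out : p.Prime).ne_zero]

/-! ### Cubes in principal quadratic orders; the rings `ℤ[√2]` and `ℤ[ω]` -/

/-- If every prime divides a nonzero `a` to a power divisible by `n`, then `a` is an `n`-th power up
to a unit. -/
theorem exists_isUnit_mul_pow {R : Type*} [CommRing R] [IsDomain R] [UniqueFactorizationMonoid R]
    (n : ℕ) (a : R) (ha : a ≠ 0)
    (h : ∀ π : R, Prime π → ∀ k u, a = π ^ k * u → ¬ π ∣ u → n ∣ k) :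
    ∃ u c, IsUnit u ∧ a = u * c ^ n := by
  induction a using IsWellFounded.induction (DvdNotUnit (α := R)) with
  | _ a ih =>
    by_cases hu : IsUnit a
    · exact ⟨a, 1, hu, by simp⟩
    obtain ⟨π, hπ, hπa⟩ := WfDvdMonoid.exists_irreducible_factor hu ha
    have hπ' : Prime π := hπ.prime
    obtain ⟨c, hc, hc'⟩ := (FiniteMultiplicity.of_prime_left hπ' ha).exists_eq_pow_mul_and_not_dvd
    set k := multiplicity π a with hk
    have hk0 : k ≠ 0 := fun h0 => hc' (by rw [h0, pow_zero, one_mul] at hc; rwa [← hc])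
    have hc0 : c ≠ 0 := fun h0 => hc' (h0 ▸ dvd_zero _)
    have hlt : DvdNotUnit c a := ⟨hc0, π ^ k,
      fun hh => hπ'.not_isUnit ((isUnit_pow_iff hk0).1 hh), by rw [mul_comm]; exact hc⟩
    obtain ⟨u, d, hu, hd⟩ := ih c hlt hc0 fun q hq j w hw hqw => by
      by_cases hqπ : q ∣ π
      · have : j = 0 := by
          by_contra hj
          have := (hq.irreducible.associated_of_dvd hπ hqπ).dvd'
          exact hc' (this.trans (hw ▸ (dvd_pow_self q hj).mul_right w))
        simp [this]
      · refine h q hq j (π ^ k * w) (by rw [hc, hw]; ring) fun hh => ?_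
        rcases hq.dvd_or_dvd hh with h1 | h1
        · exact hqπ (hq.dvd_of_dvd_pow h1)
        · exact hqw h1
    obtain ⟨m, hm⟩ := h π hπ' k c hc hc'
    exact ⟨u, π ^ m * d, hu, by rw [hc, hd, hm]; ring⟩

theorem isPrincipalIdealRing_of_division {R : Type*} [CommRing R] (N : R → ℕ)
    (h : ∀ a b : R, b ≠ 0 → ∃ q, a - q * b = 0 ∨ N (a - q * b) < N b) :
    IsPrincipalIdealRing R := by
  refine ⟨fun I => ?_⟩
  by_cases hI : I = ⊥
  · exact ⟨0, by simp [hI]⟩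
  obtain ⟨x, hx, hx0⟩ := Submodule.exists_mem_ne_zero_of_ne_bot hI
  obtain ⟨b, ⟨hb, hb0⟩, hmin⟩ := (InvImage.wf N wellFounded_lt).has_min
    {x | x ∈ I ∧ x ≠ 0} ⟨x, hx, hx0⟩
  refine ⟨b, le_antisymm (fun a ha => ?_) ((Submodule.span_singleton_le_iff_mem _ _).2 hb)⟩
  obtain ⟨q, hq | hq⟩ := h a b hb0
  · exact Submodule.mem_span_singleton.2 ⟨q, (sub_eq_zero.1 hq).symm⟩
  · by_cases h0 : a - q * b = 0
    · exact Submodule.mem_span_singleton.2 ⟨q, (sub_eq_zero.1 h0).symm⟩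
    · exact absurd hq (hmin _ ⟨sub_mem ha (I.mul_mem_left q hb), h0⟩)

theorem exists_two_mul_abs_sub_le (c n : ℤ) (hn : n ≠ 0) : ∃ q : ℤ, 2 * |c - q * n| ≤ |n| := by
  refine ⟨round ((c : ℚ) / n), ?_⟩
  have h := abs_sub_round ((c : ℚ) / n)
  have hn' : (n : ℚ) ≠ 0 := by exact_mod_cast hn
  have : (|c - round ((c : ℚ) / n) * n| : ℚ) = |(c : ℚ) / n - round ((c : ℚ) / n)| * |(n : ℚ)| := by
    rw [← abs_mul, sub_mul, div_mul_cancel₀ _ hn']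
  have h2 : 2 * (|c - round ((c : ℚ) / n) * n| : ℚ) ≤ |(n : ℚ)| := by
    rw [this]; nlinarith [abs_nonneg (n : ℚ)]
  exact_mod_cast h2

namespace QuadraticAlgebra

/-- A quadratic order whose norm is less than `n²` on the box `|re|, |im| ≤ n / 2` is
norm-Euclidean: divide in the fraction field and round both coordinates. -/
theorem isPrincipalIdealRing_of_abs_norm_lt {a b : ℤ}
    (hN : ∀ z : QuadraticAlgebra ℤ a b, z.norm = 0 → z = 0)
    (h : ∀ n : ℤ, n ≠ 0 → ∀ z : QuadraticAlgebra ℤ a b,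
      2 * |z.re| ≤ |n| → 2 * |z.im| ≤ |n| → |z.norm| < n ^ 2) :
    IsPrincipalIdealRing (QuadraticAlgebra ℤ a b) := by
  refine isPrincipalIdealRing_of_division (fun z => z.norm.natAbs) fun x y hy => ?_
  have hn : y.norm ≠ 0 := fun h0 => hy (hN y h0)
  obtain ⟨q₁, h₁⟩ := exists_two_mul_abs_sub_le (x * star y).re y.norm hn
  obtain ⟨q₂, h₂⟩ := exists_two_mul_abs_sub_le (x * star y).im y.norm hn
  refine ⟨⟨q₁, q₂⟩, Or.inr ?_⟩
  have key : (x - ⟨q₁, q₂⟩ * y) * star y =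
      ⟨(x * star y).re - q₁ * y.norm, (x * star y).im - q₂ * y.norm⟩ := by
    have : y * star y = ⟨y.norm, 0⟩ := (algebraMap_norm_eq_mul_star y).symm
    rw [sub_mul, mul_assoc, this]
    ext <;> simp
  have h3 := h _ hn ⟨_, _⟩ h₁ h₂
  rw [← key, map_mul, norm_star, abs_mul] at h3
  have : |(x - ⟨q₁, q₂⟩ * y).norm| < |y.norm| := by
    rw [← sq_abs, sq] at h3
    exact lt_of_mul_lt_mul_right h3 (abs_nonneg _)
  zify; exact this

theorem isDomain_of_norm {a b : ℤ}
    (hN : ∀ z : QuadraticAlgebra ℤ a b, z.norm = 0 → z = 0) :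
    IsDomain (QuadraticAlgebra ℤ a b) := by
  have : NoZeroDivisors (QuadraticAlgebra ℤ a b) :=
    ⟨fun {x y} h => (mul_eq_zero.1 (by rw [← map_mul, h, norm_zero] : x.norm * y.norm = 0)).imp
      (hN x) (hN y)⟩
  exact NoZeroDivisors.to_isDomain _

/-- Let `α` have a cube as its norm. If the primes not dividing `6` divide `α` to powers divisible
by `3` and there is only one prime above each of `2` and `3`, then `α` is a cube up to a unit: the
exponent of the prime above `2` or `3` can be read off from the norm. -/
theorem exists_isUnit_mul_cube {a b : ℤ} [IsDomain (QuadraticAlgebra ℤ a b)]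
    [IsPrincipalIdealRing (QuadraticAlgebra ℤ a b)]
    (hp : ∀ p : ℕ, p = 2 ∨ p = 3 → ∃ π : QuadraticAlgebra ℤ a b,
      (π.norm.natAbs = p ∨ π.norm.natAbs = p ^ 2) ∧
        ∀ x : QuadraticAlgebra ℤ a b, (p : ℤ) ∣ x.norm → π ∣ x)
    {α : QuadraticAlgebra ℤ a b} (hα : α ≠ 0) {r : ℤ} (hr : α.norm = r ^ 3)
    (h : ∀ π : QuadraticAlgebra ℤ a b, Prime π → ¬ π ∣ 6 → ∀ k u, α = π ^ k * u → ¬ π ∣ u →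
      3 ∣ k) :
    ∃ u c, IsUnit u ∧ α = u * c ^ 3 := by
  refine exists_isUnit_mul_pow 3 α hα fun π hπ k u hk hu => ?_
  by_cases h6 : π ∣ 6
  swap
  · exact h π hπ h6 k u hk hu
  obtain ⟨p, hp', hπp⟩ : ∃ p : ℕ, (p = 2 ∨ p = 3) ∧ π ∣ (p : QuadraticAlgebra ℤ a b) := by
    have : (6 : QuadraticAlgebra ℤ a b) = (2 : ℕ) * (3 : ℕ) := by norm_num
    rcases hπ.dvd_or_dvd (this ▸ h6) with h1 | h1
    · exact ⟨2, Or.inl rfl, h1⟩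
    · exact ⟨3, Or.inr rfl, h1⟩
  have hpp : p.Prime := by rcases hp' with rfl | rfl <;> norm_num
  obtain ⟨π', hN, hπ'⟩ := hp p hp'
  have hdvd (x : QuadraticAlgebra ℤ a b) (hx : π ∣ x) : (p : ℤ) ∣ x.norm := by
    have h1 : π.norm ∣ (p : ℤ) ^ 2 := by
      simpa using map_dvd norm hπp
    have h2 : π.norm.natAbs ∣ p ^ 2 := by
      simpa [Int.natAbs_pow] using Int.natAbs_dvd_natAbs.2 h1
    obtain ⟨i, hi, hi'⟩ := (Nat.dvd_prime_pow hpp).1 h2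
    have hi0 : i ≠ 0 := by
      rintro rfl
      exact hπ.not_isUnit (isUnit_iff_norm_isUnit.2 (Int.isUnit_iff_natAbs_eq.2
        (by simpa using hi')))
    refine Int.natCast_dvd.2 ?_
    exact ((hi' ▸ dvd_pow_self p hi0)).trans (Int.natAbs_dvd_natAbs.2 (map_dvd norm hx))
  have hassoc : π' ∣ π := hπ' π (hdvd π dvd_rfl)
  have hassoc' : Associated π π' := (hπ.irreducible.dvd_iff.1 hassoc).resolve_left <| by
    rw [isUnit_iff_norm_isUnit, Int.isUnit_iff_natAbs_eq]
    rcases hN with hN | hN <;> rw [hN] <;> simp [hpp.ne_one]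
  have hu' : ¬ p ∣ u.norm.natAbs := fun hh => hu <|
    hassoc'.dvd.trans (hπ' u (Int.natCast_dvd.2 hh))
  obtain ⟨f, hf, hπf⟩ : ∃ f, (f = 1 ∨ f = 2) ∧ π.norm.natAbs = p ^ f := by
    have h1 : π.norm.natAbs = π'.norm.natAbs :=
      Int.natAbs_eq_iff_associated.2 (hassoc'.map norm)
    rw [h1]
    rcases hN with hN | hN
    · exact ⟨1, Or.inl rfl, by rw [hN, pow_one]⟩
    · exact ⟨2, Or.inr rfl, hN⟩
  -- Compare the exponents of `p` in `|N(α)| = p ^ (f * k) * |N(u)|` and in `|r| ^ 3`.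
  have h1 : p ^ (f * k) * u.norm.natAbs = r.natAbs ^ 3 := by
    rw [← Int.natAbs_pow, ← hr, hk, map_mul, map_pow, Int.natAbs_mul, Int.natAbs_pow, hπf, pow_mul]
  have : Fact p.Prime := ⟨hpp⟩
  have h2 := congrArg (padicValNat p) h1
  have hu0 : u.norm.natAbs ≠ 0 := fun h0 => hu' (h0 ▸ dvd_zero p)
  rw [padicValNat.mul (pow_ne_zero _ hpp.ne_zero) hu0, padicValNat.prime_pow,
    padicValNat.pow, padicValNat.eq_zero_of_not_dvd hu'] at h2
  rcases hf with rfl | rfl <;> omega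

end QuadraticAlgebra

/-- The ring `ℤ[√2]`. -/
abbrev ZSqrtTwo : Type := QuadraticAlgebra ℤ 2 0

/-- The ring `ℤ[ω]` of Eisenstein integers, with `ω² + ω + 1 = 0`. -/
abbrev Eisenstein : Type := QuadraticAlgebra ℤ (-1) (-1)

section QuadraticIntegers

open QuadraticAlgebra

namespace ZSqrtTwo

theorem norm_eq (z : ZSqrtTwo) : z.norm = z.re ^ 2 - 2 * z.im ^ 2 := by
  rw [norm_def]; ring

theorem eq_zero_of_norm_eq_zero (z : ZSqrtTwo) (h : z.norm = 0) : z = 0 := by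
  rw [norm_eq] at h
  have hy : z.im = 0 := by
    by_contra hy
    have h2 : IsSquare (2 : ℚ) := ⟨z.re / z.im, by
      have hy' : (z.im : ℚ) ≠ 0 := by exact_mod_cast hy
      field_simp
      have : (z.re : ℚ) ^ 2 - 2 * z.im ^ 2 = 0 := by exact_mod_cast h
      linarith⟩
    norm_num at h2
  have hx : z.re = 0 := by simpa [hy] using h
  ext <;> simp [hx, hy]

instance : IsDomain ZSqrtTwo := isDomain_of_norm eq_zero_of_norm_eq_zero

instance : IsPrincipalIdealRing ZSqrtTwo :=
  isPrincipalIdealRing_of_abs_norm_lt eq_zero_of_norm_eq_zero fun n hn z h1 h2 => by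
    have hn' : 0 < n ^ 2 := by positivity
    have h1' : 4 * z.re ^ 2 ≤ n ^ 2 := by
      have := sq_le_sq.2 (by rwa [abs_mul, abs_two] : |2 * z.re| ≤ |n|)
      linarith
    have h2' : 4 * z.im ^ 2 ≤ n ^ 2 := by
      have := sq_le_sq.2 (by rwa [abs_mul, abs_two] : |2 * z.im| ≤ |n|)
      linarith
    rw [norm_eq, abs_lt]
    constructor <;> nlinarith [sq_nonneg z.re, sq_nonneg z.im]

theorem exists_prime_above (p : ℕ) (hp : p = 2 ∨ p = 3) : ∃ π : ZSqrtTwo,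
    (π.norm.natAbs = p ∨ π.norm.natAbs = p ^ 2) ∧ ∀ x : ZSqrtTwo, (p : ℤ) ∣ x.norm → π ∣ x := by
  rcases hp with rfl | rfl
  · refine ⟨⟨0, 1⟩, Or.inl (by simp [norm_eq]), fun x hx => ?_⟩
    have h2 : (2 : ℤ) ∣ x.re := by
      rw [norm_eq] at hx
      exact Int.prime_two.dvd_of_dvd_pow ((dvd_sub_left (dvd_mul_right 2 _)).1 hx)
    obtain ⟨c, hc⟩ := h2
    exact ⟨⟨x.im, c⟩, by ext <;> simp [hc]⟩
  · refine ⟨⟨3, 0⟩, Or.inr (by simp [norm_eq]), fun x hx => ?_⟩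
    rw [norm_eq] at hx
    have h3 : ∀ a b : ZMod 3, a ^ 2 - 2 * b ^ 2 = 0 → a = 0 ∧ b = 0 := by decide
    obtain ⟨ha, hb⟩ := h3 x.re x.im (by
      have := (ZMod.intCast_zmod_eq_zero_iff_dvd _ 3).2 hx
      exact_mod_cast this)
    obtain ⟨c, hc⟩ := (ZMod.intCast_zmod_eq_zero_iff_dvd _ 3).1 ha
    obtain ⟨d, hd⟩ := (ZMod.intCast_zmod_eq_zero_iff_dvd _ 3).1 hb
    exact ⟨⟨c, d⟩, by ext <;> simp [hc, hd]⟩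

/-- A unit `x + y√2` of `ℤ[√2]` with `x`, `y` of the same sign gets a smaller coefficient of `√2` on
division by `1 + √2`. -/
theorem sq_sub_lt_sq {x y : ℤ} (h : x ^ 2 - 2 * y ^ 2 = 1 ∨ x ^ 2 - 2 * y ^ 2 = -1)
    (hxy : 0 < x * y) : (x - y) ^ 2 < y ^ 2 := by
  have hx : 0 < x ^ 2 := by
    have : x ≠ 0 := by rintro rfl; simp at hxy
    positivity
  have hy : 0 < y ^ 2 := by
    have : y ≠ 0 := by rintro rfl; simp at hxy
    positivity
  have h1 : x ^ 2 < 4 * y ^ 2 := by rcases h with h | h <;> linarith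
  have h2 : (x ^ 2) ^ 2 < (2 * (x * y)) ^ 2 := by
    calc (x ^ 2) ^ 2 = x ^ 2 * x ^ 2 := by ring
      _ < x ^ 2 * (4 * y ^ 2) := by gcongr
      _ = _ := by ring
  have h3 := lt_of_pow_lt_pow_left₀ 2 (by linarith) h2
  linarith

/-- The units of `ℤ[√2]` are `± (1 + √2) ^ m`. The statement is about their images in a field, where
negative exponents make sense. -/
theorem exists_zpow_of_isUnit {F : Type*} [Field F] (f : ZSqrtTwo →+* F) {u : ZSqrtTwo}
    (hu : IsUnit u) : ∃ m : ℤ, f u = f ⟨1, 1⟩ ^ m ∨ f u = -f ⟨1, 1⟩ ^ m := by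
  have hε : f ⟨1, 1⟩ * f ⟨-1, 1⟩ = 1 := by
    rw [← map_mul, ← map_one f]
    congr 1
  have hε0 : f ⟨1, 1⟩ ≠ 0 := left_ne_zero_of_mul_eq_one hε
  suffices ∀ n : ℕ, ∀ u : ZSqrtTwo, IsUnit u → u.im.natAbs ≤ n →
      ∃ m : ℤ, f u = f ⟨1, 1⟩ ^ m ∨ f u = -f ⟨1, 1⟩ ^ m from this _ u hu le_rfl
  intro n
  induction n with
  | zero =>
    intro u hu hn
    have h0 : u.im = 0 := by simpa using hn
    have h1 := isUnit_iff_norm_isUnit.1 hu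
    rw [norm_eq, h0] at h1
    have h2 : IsUnit u.re := by simpa using h1
    refine ⟨0, (Int.isUnit_iff.1 h2).imp (fun h => ?_) (fun h => ?_)⟩
    · rw [show u = 1 by ext <;> simp [h0, h], map_one, zpow_zero]
    · rw [show u = -1 by ext <;> simp [h0, h], map_neg, map_one, zpow_zero]
  | succ n ih =>
    intro u hu hn
    by_cases h0 : u.im = 0
    · exact ih u hu (by simp [h0])
    have h1 := Int.isUnit_iff.1 (isUnit_iff_norm_isUnit.1 hu)
    rw [norm_eq] at h1
    -- Multiplication by one of `√2 ± 1` makes the coefficient of `√2` smaller.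
    have hle (v : ℤ) (hv : v ^ 2 < u.im ^ 2) : v.natAbs ≤ n := by
      have := Int.natAbs_lt_iff_sq_lt.2 hv
      omega
    by_cases hxy : 0 < u.re * u.im
    · obtain ⟨m, hm⟩ := ih (u * ⟨-1, 1⟩) (hu.mul (.of_mul_eq_one ⟨1, 1⟩ (by rfl))) (by
        refine hle _ ?_
        have := sq_sub_lt_sq h1 hxy
        convert this using 2
        simp
        ring)
      refine ⟨m + 1, ?_⟩
      rw [zpow_add_one₀ hε0, show f u = f (u * ⟨-1, 1⟩) * f ⟨1, 1⟩ by
        rw [map_mul, mul_assoc, mul_comm (f ⟨-1, 1⟩), hε, mul_one], ← neg_mul]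
      exact hm.imp (fun h => by rw [h]) (fun h => by rw [h])
    · obtain ⟨m, hm⟩ := ih (u * ⟨1, 1⟩) (hu.mul (.of_mul_eq_one ⟨-1, 1⟩ (by rfl))) (by
        refine hle _ ?_
        have hre : u.re ≠ 0 := by
          intro h
          rw [h] at h1
          omega
        have := sq_sub_lt_sq (x := u.re) (y := -u.im) (by simpa using h1) (by
          have := mul_ne_zero hre h0
          rw [mul_neg]
          omega)
        convert this using 1
        · simp
        · simp)
      refine ⟨m - 1, ?_⟩
      rw [zpow_sub_one₀ hε0, show f u = f (u * ⟨1, 1⟩) * (f ⟨1, 1⟩)⁻¹ by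
        rw [map_mul, mul_assoc, mul_inv_cancel₀ hε0, mul_one], ← neg_mul]
      exact hm.imp (fun h => by rw [h]) (fun h => by rw [h])

end ZSqrtTwo

namespace Eisenstein

theorem norm_eq (z : Eisenstein) : z.norm = z.re ^ 2 - z.re * z.im + z.im ^ 2 := by
  rw [norm_def]; ring

theorem eq_zero_of_norm_eq_zero (z : Eisenstein) (h : z.norm = 0) : z = 0 := by
  rw [norm_eq] at h
  have hy : z.im = 0 := by nlinarith [sq_nonneg (2 * z.re - z.im), sq_nonneg z.im]
  have hx : z.re = 0 := by simpa [hy] using h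
  ext <;> simp [hx, hy]

instance : IsDomain Eisenstein := isDomain_of_norm eq_zero_of_norm_eq_zero

instance : IsPrincipalIdealRing Eisenstein :=
  isPrincipalIdealRing_of_abs_norm_lt eq_zero_of_norm_eq_zero fun n hn z h1 h2 => by
    have hn' : 0 < n ^ 2 := by positivity
    have h1' : 4 * z.re ^ 2 ≤ n ^ 2 := by
      have := sq_le_sq.2 (by rwa [abs_mul, abs_two] : |2 * z.re| ≤ |n|)
      linarith
    have h2' : 4 * z.im ^ 2 ≤ n ^ 2 := by
      have := sq_le_sq.2 (by rwa [abs_mul, abs_two] : |2 * z.im| ≤ |n|)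
      linarith
    rw [norm_eq, abs_lt]
    constructor <;> nlinarith [sq_nonneg (z.re + z.im), sq_nonneg (z.re - z.im)]

theorem exists_prime_above (p : ℕ) (hp : p = 2 ∨ p = 3) : ∃ π : Eisenstein,
    (π.norm.natAbs = p ∨ π.norm.natAbs = p ^ 2) ∧ ∀ x : Eisenstein, (p : ℤ) ∣ x.norm → π ∣ x := by
  rcases hp with rfl | rfl
  · refine ⟨⟨2, 0⟩, Or.inr (by simp [norm_eq]), fun x hx => ?_⟩
    rw [norm_eq] at hx
    have h2 : ∀ a b : ZMod 2, a ^ 2 - a * b + b ^ 2 = 0 → a = 0 ∧ b = 0 := by decide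
    obtain ⟨ha, hb⟩ := h2 x.re x.im (by
      have := (ZMod.intCast_zmod_eq_zero_iff_dvd _ 2).2 hx
      exact_mod_cast this)
    obtain ⟨c, hc⟩ := (ZMod.intCast_zmod_eq_zero_iff_dvd _ 2).1 ha
    obtain ⟨d, hd⟩ := (ZMod.intCast_zmod_eq_zero_iff_dvd _ 2).1 hb
    exact ⟨⟨c, d⟩, by ext <;> simp [hc, hd]⟩
  · refine ⟨⟨1, -1⟩, Or.inl (by simp [norm_eq]), fun x hx => ?_⟩
    rw [norm_eq] at hx
    have h3 : ∀ a b : ZMod 3, a ^ 2 - a * b + b ^ 2 = 0 → a + b = 0 := by decide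
    have h := h3 x.re x.im (by
      have := (ZMod.intCast_zmod_eq_zero_iff_dvd _ 3).2 hx
      exact_mod_cast this)
    obtain ⟨c, hc⟩ := (ZMod.intCast_zmod_eq_zero_iff_dvd (x.re + x.im) 3).1 (by exact_mod_cast h)
    -- `x + yω = (1 - ω)((2x - y)/3 + ((x + y)/3) ω)`
    refine ⟨⟨x.re - c, c⟩, ?_⟩
    push_cast at hc
    ext
    · simp
    · simp
      linarith

/-- The unit group of the Eisenstein integers has exponent `6`. -/
theorem pow_six_eq_one_of_isUnit {u : Eisenstein} (hu : IsUnit u) : u ^ 6 = 1 := by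
  have h1 := Int.isUnit_iff.1 (isUnit_iff_norm_isUnit.1 hu)
  rw [norm_eq] at h1
  have hx : u.re ^ 2 ≤ 1 := by
    rcases h1 with h1 | h1 <;> nlinarith [sq_nonneg (u.re - 2 * u.im), sq_nonneg u.im]
  have hy : u.im ^ 2 ≤ 1 := by
    rcases h1 with h1 | h1 <;> nlinarith [sq_nonneg (2 * u.re - u.im), sq_nonneg u.im]
  obtain ⟨x, y⟩ := u
  simp only at h1 hx hy
  obtain ⟨hx1, hx2⟩ := abs_le.1 ((sq_le_one_iff_abs_le_one x).1 hx)
  obtain ⟨hy1, hy2⟩ := abs_le.1 ((sq_le_one_iff_abs_le_one y).1 hy)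
  interval_cases x <;> interval_cases y <;> first | (norm_num at h1; done) | rfl

end Eisenstein

end QuadraticIntegers

/-! ### Powers in unramified extensions -/

/-- Let `f : R → B` be an integral extension of a principal ideal domain by a Dedekind domain in
which `p` is unramified. If `f a` is an `n`-th power, then the primes of `R` dividing `p` divide `a`
to powers divisible by `n`. -/
theorem dvd_of_map_eq_pow {R B : Type*} [CommRing R] [IsDomain R] [IsPrincipalIdealRing R]
    [CommRing B] [IsDedekindDomain B] (f : R →+* B) (hf : f.IsIntegral)
    (hinj : Function.Injective f) {p : ℕ}
    (hp : ∀ 𝔭 : Ideal B, 𝔭.IsPrime → (p : B) ∈ 𝔭 → (p : B) ∉ 𝔭 ^ 2)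
    {π u a : R} {b : B} {k n : ℕ} (hπ : Prime π) (hπp : π ∣ p) (ha : a = π ^ k * u) (hu : ¬ π ∣ u)
    (hb : f a = b ^ n) : n ∣ k := by
  let _ : Algebra R B := f.toAlgebra
  have : Algebra.IsIntegral R B := ⟨hf⟩
  have : FaithfulSMul R B := (faithfulSMul_iff_algebraMap_injective R B).2 hinj
  have : (Ideal.span {π}).IsPrime := (Ideal.span_singleton_prime hπ.ne_zero).2 hπ
  obtain ⟨⟨𝔭, h𝔭, hover⟩⟩ := (inferInstance : Nonempty ((Ideal.span {π}).primesOver B))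
  have hmem (x : R) : f x ∈ 𝔭 ↔ π ∣ x := by
    rw [← Ideal.mem_span_singleton, hover.over]
    rfl
  have h𝔭0 : 𝔭 ≠ ⊥ := by
    rintro rfl
    exact hπ.ne_zero (hinj (((hmem π).2 dvd_rfl : f π = 0).trans (map_zero f).symm))
  have hprime : Prime 𝔭 := Ideal.prime_of_isPrime h𝔭0 h𝔭
  have hdvd (x : B) (m : ℕ) : 𝔭 ^ m ∣ Ideal.span {x} ↔ x ∈ 𝔭 ^ m :=
    Ideal.dvd_iff_le.trans (Ideal.span_singleton_le_iff_mem _)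
  have h1 : emultiplicity 𝔭 (Ideal.span {f π}) = (1 : ℕ) := by
    refine emultiplicity_eq_coe.2 ⟨?_, ?_⟩
    · rw [hdvd, pow_one, hmem]
    · rw [hdvd]
      intro h
      obtain ⟨c, hc⟩ := hπp
      refine hp 𝔭 h𝔭 ?_ ?_ <;> rw [← map_natCast f, hc, map_mul]
      · exact Ideal.mul_mem_right _ _ ((hmem π).2 dvd_rfl)
      · exact Ideal.mul_mem_right _ _ h
  have h2 : emultiplicity 𝔭 (Ideal.span {f u}) = (0 : ℕ) := by
    refine emultiplicity_eq_coe.2 ⟨by simp, ?_⟩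
    rwa [hdvd, zero_add, pow_one, hmem]
  have h3 : emultiplicity 𝔭 (Ideal.span {f a}) = (k : ℕ) := by
    rw [ha, map_mul, map_pow, ← Ideal.span_singleton_mul_span_singleton,
      ← Ideal.span_singleton_pow, emultiplicity_mul hprime, emultiplicity_pow hprime, h1, h2]
    simp
  rw [hb, ← Ideal.span_singleton_pow, emultiplicity_pow hprime] at h3
  by_cases hn : n = 0
  · subst hn
    simp only [Nat.cast_zero, zero_mul] at h3
    exact zero_dvd_iff.2 (by exact_mod_cast h3.symm)
  · have hfin : emultiplicity 𝔭 (Ideal.span {b}) ≠ ⊤ := by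
      intro h
      rw [h, ENat.mul_top (by simpa using hn)] at h3
      exact ENat.natCast_ne_top k h3.symm
    obtain ⟨m, hm⟩ := ENat.ne_top_iff_exists.1 hfin
    rw [← hm] at h3
    exact ⟨m, by exact_mod_cast h3.symm⟩

/-- Let `M/ℚ` be a finite Galois extension inside `ℚ̄` in which `p` does not ramify. An element of a
principal ideal domain `R ⊆ M` that becomes an `n`-th power in `M` is divisible by the primes of `R`
above `p` to powers divisible by `n`. -/
theorem dvd_of_map_eq_pow_of_inertia_le {R : Type*} [CommRing R] [IsDomain R]
    [IsPrincipalIdealRing R] [Module.Finite ℤ R] (f : R →+* Ω) (hf : Function.Injective f)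
    (M : IntermediateField ℚ Ω) [IsGalois ℚ M] [FiniteDimensional ℚ M] {p : ℕ} [Fact p.Prime]
    (hM : ∀ P : Ideal (𝓞 Ω), P.IsPrime →
      P.LiesOver (Ideal.span {(p : ℤ)}) → P.inertia GQ ≤ M.fixingSubgroup)
    (hfM : ∀ x, f x ∈ M) {b : Ω} (hbM : b ∈ M)
    {π u a : R} {k n : ℕ} (hπ : Prime π) (hπp : π ∣ p) (ha : a = π ^ k * u) (hu : ¬ π ∣ u)
    (hn : n ≠ 0) (hb : f a = b ^ n) : n ∣ k := by
  have : NumberField M := ⟨⟩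
  have hint (x : R) : IsIntegral ℤ (⟨f x, hfM x⟩ : M) :=
    (Algebra.IsIntegral.isIntegral (R := ℤ) x).map (f.codRestrict M hfM).toIntAlgHom
  have hb' : IsIntegral ℤ (⟨b, hbM⟩ : M) :=
    .of_pow (Nat.pos_of_ne_zero hn) (by convert hint a using 1; exact Subtype.ext hb.symm)
  let g : R →+* 𝓞 M := (f.codRestrict M hfM).codRestrict (integralClosure ℤ M) hint
  refine dvd_of_map_eq_pow (p := p) g ?_ (fun x y h => hf ?_) ?_ hπ hπp ha hu
    (b := ⟨⟨b, hbM⟩, hb'⟩) (n := n) ?_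
  · refine RingHom.IsIntegral.tower_top (Int.castRingHom R) g ?_
    rw [RingHom.ext_int (g.comp (Int.castRingHom R)) (algebraMap ℤ (𝓞 M))]
    exact algebraMap_isIntegral_iff.2 inferInstance
  · exact congrArg (fun z : 𝓞 M => (algebraMap (𝓞 M) M z : Ω)) h
  · intro 𝔭 h𝔭 hp𝔭
    have : 𝔭.LiesOver (Ideal.span {(p : ℤ)}) := by
      refine ⟨(Int.ideal_span_isMaximal_of_prime p).eq_of_le ?_ ?_⟩
      · exact (h𝔭.under ℤ).ne_top
      · rw [Ideal.span_singleton_le_iff_mem]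
        simpa [Ideal.under] using hp𝔭
    exact natCast_notMem_sq M hM 𝔭
  · exact Subtype.ext (Subtype.ext hb)

/-! ### Actions of the absolute Galois group on three letters -/

theorem perm3_exists_pow_apply : ∀ c : Equiv.Perm (Fin 3), (∀ i, c i ≠ i) →
    ∀ i, ∃ k : Fin 3, (c ^ k.val) 0 = i := by
  decide

theorem perm3_eq_or_eq_of_ne : ∀ c : Equiv.Perm (Fin 3), (∀ i, c i ≠ i) →
    ∀ i j, i ≠ j → j = c i ∨ i = c j := by
  decide

set_option synthInstance.maxSize 1000 in
set_option synthInstance.maxHeartbeats 200000 in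
theorem perm3_sign_eq_one_iff : ∀ c : Equiv.Perm (Fin 3), Equiv.Perm.sign c = 1 ↔
    c = 1 ∨ (c 0 = 1 ∧ c 1 = 2 ∧ c 2 = 0) ∨ (c 0 = 2 ∧ c 1 = 0 ∧ c 2 = 1) := by
  decide

set_option synthInstance.maxSize 1000 in
set_option synthInstance.maxHeartbeats 200000 in
theorem perm3_sign_eq_neg_one_iff : ∀ c : Equiv.Perm (Fin 3), Equiv.Perm.sign c = -1 ↔
    (c 0 = 0 ∧ c 1 = 2 ∧ c 2 = 1) ∨ (c 0 = 1 ∧ c 1 = 0 ∧ c 2 = 2) ∨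
      (c 0 = 2 ∧ c 1 = 1 ∧ c 2 = 0) := by
  decide

theorem perm3_sign_eq_one_of_forall_ne : ∀ c : Equiv.Perm (Fin 3), (∀ i, c i ≠ i) →
    Equiv.Perm.sign c = 1 ∧ c ^ 2 ≠ 1 := by
  decide

theorem perm3_eq_one_of_sign_of_apply_eq : ∀ c : Equiv.Perm (Fin 3), Equiv.Perm.sign c = 1 →
    ∀ i, c i = i → c = 1 := by
  decide

theorem perm3_eq_one_of_sign_of_sq : ∀ c : Equiv.Perm (Fin 3), Equiv.Perm.sign c = 1 →
    c ^ 2 = 1 → c = 1 := by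
  decide

set_option synthInstance.maxSize 1000 in
set_option synthInstance.maxHeartbeats 200000 in
theorem perm3_exists_pow_mul_pow : ∀ c t : Equiv.Perm (Fin 3), (∀ i, c i ≠ i) →
    Equiv.Perm.sign t = -1 → ∀ x, ∃ i j : Fin 3, x = c ^ i.val * t ^ j.val := by
  decide

/-- A transitive action of the absolute Galois group on three letters is the action on three
conjugate elements of `ℚ̄`: take the conjugates of an element of the fixed field of a stabilizer
that is moved by the fixed-point-free element `γ`. -/
theorem exists_equivariant (s : GQ →* Equiv.Perm (Fin 3)) (hs : IsOpen (s.ker : Set GQ))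
    {γ : GQ} (hγ : ∀ i, s γ i ≠ i) :
    ∃ θ : Fin 3 → Ω, Function.Injective θ ∧ ∀ (σ : GQ) i, σ (θ i) = θ (s σ i) := by
  let U : Subgroup GQ := (MulAction.stabilizer (Equiv.Perm (Fin 3)) (0 : Fin 3)).comap s
  have hU (σ : GQ) : σ ∈ U ↔ s σ 0 = 0 := Iff.rfl
  have hUo : IsOpen (U : Set GQ) := Subgroup.isOpen_mono (H₁ := s.ker) (fun σ hσ => by
    rw [hU, MonoidHom.mem_ker.1 hσ, Equiv.Perm.one_apply]) hs
  have hUf : (IntermediateField.fixedField U).fixingSubgroup = U :=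
    InfiniteGalois.fixingSubgroup_fixedField ⟨U, Subgroup.isClosed_of_isOpen U hUo⟩
  obtain ⟨a, ha, haγ⟩ : ∃ a ∈ IntermediateField.fixedField U, γ a ≠ a := by
    by_contra! h
    have : γ ∈ U := by
      rw [← hUf]
      exact (IntermediateField.mem_fixingSubgroup_iff _ _).2 h
    exact hγ 0 this
  have ha' (σ : GQ) (hσ : s σ 0 = 0) : σ a = a := ha ⟨σ, hσ⟩
  have htrans (i : Fin 3) : ∃ τ : GQ, s τ 0 = i := by
    obtain ⟨k, hk⟩ := perm3_exists_pow_apply (s γ) hγ i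
    exact ⟨γ ^ k.val, by rw [map_pow, hk]⟩
  choose τ hτ using htrans
  have key (σ σ' : GQ) (h : s σ 0 = s σ' 0) : σ a = σ' a := by
    have := ha' (σ'⁻¹ * σ) (by
      rw [map_mul, map_inv, Equiv.Perm.mul_apply, h]
      exact (s σ').symm_apply_apply 0)
    exact (σ'.symm_apply_eq).1 this
  have hequiv (σ : GQ) (i) : σ (τ i a) = τ (s σ i) a :=
    key (σ * τ i) _ (by rw [map_mul, Equiv.Perm.mul_apply, hτ, hτ])
  have h0 : τ 0 a = a := ha' _ (hτ 0)
  have hne (i : Fin 3) : τ (s γ i) a ≠ τ i a := by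
    obtain ⟨k, rfl⟩ := perm3_exists_pow_apply (s γ) hγ i
    have h1 : τ ((s γ ^ k.val) 0) a = (γ ^ k.val) a := by rw [← map_pow, ← hequiv, h0]
    rw [← hequiv, h1, ← AlgEquiv.mul_apply, ← pow_succ', pow_succ]
    exact fun h => haγ ((γ ^ k.val).injective h)
  refine ⟨fun i => τ i a, fun i j hij => ?_, hequiv⟩
  by_contra hne'
  rcases perm3_eq_or_eq_of_ne (s γ) hγ i j hne' with h | h
  · exact hne i (h ▸ hij.symm)
  · exact hne j (h ▸ hij)

/-- An open normal subgroup of the absolute Galois group is the Galois group of `ℚ̄` over a finite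
Galois extension of `ℚ`. -/
theorem exists_fixingSubgroup_eq (U : Subgroup GQ) [U.Normal] (hU : IsOpen (U : Set GQ)) :
    ∃ M : IntermediateField ℚ Ω, IsGalois ℚ M ∧ FiniteDimensional ℚ M ∧ M.fixingSubgroup = U ∧
      ∀ x, (∀ σ ∈ U, σ x = x) → x ∈ M := by
  have h : (IntermediateField.fixedField U).fixingSubgroup = U :=
    InfiniteGalois.fixingSubgroup_fixedField ⟨U, Subgroup.isClosed_of_isOpen U hU⟩
  refine ⟨IntermediateField.fixedField U, ?_, ?_, h, fun x hx σ => hx σ.1 σ.2⟩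
  · convert! (InfiniteGalois.normal_iff_isGalois (IntermediateField.fixedField U)).1
      (by rw [h]; infer_instance)
  · convert! (InfiniteGalois.isOpen_iff_finite (IntermediateField.fixedField U)).1
      (by rw [h]; exact hU)

theorem exists_rat_of_forall_fixed (x : Ω) (h : ∀ σ : GQ, σ x = x) : ∃ q : ℚ, (q : Ω) = x := by
  obtain ⟨q, hq⟩ := (InfiniteGalois.mem_range_algebraMap_iff_fixed (k := ℚ) x).2 h
  exact ⟨q, by rw [← hq, eq_ratCast]⟩

theorem Rat.exists_squarefree_mul_sq (q : ℚ) (hq : q ≠ 0) :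
    ∃ (d : ℤ) (t : ℚ), Squarefree d ∧ t ≠ 0 ∧ q = d * t ^ 2 := by
  obtain ⟨a, b, hab, ha⟩ := Nat.sq_mul_squarefree (q.num * q.den).natAbs
  have hn : q.num * q.den ≠ 0 := by simp [hq]
  have hb : (b : ℚ) ≠ 0 := by
    rintro h
    rw [Nat.cast_eq_zero.1 h] at hab
    exact hn (Int.natAbs_eq_zero.1 (by simpa using hab.symm))
  have hden : (q.den : ℚ) ≠ 0 := by simp
  have hq' : q * (q.den : ℚ) ^ 2 = ((q.num * q.den : ℤ) : ℚ) := by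
    push_cast
    rw [sq, ← mul_assoc, Rat.mul_den_eq_num]
  have key : ((b : ℤ) ^ 2 * a = q.num * q.den) ∨ -((b : ℤ) ^ 2 * a) = q.num * q.den := by
    have h1 : ((q.num * q.den).natAbs : ℤ) = b ^ 2 * a := by rw [← hab]; push_cast; ring
    rcases Int.natAbs_eq (q.num * q.den) with h | h <;> rw [h1] at h
    · exact Or.inl h.symm
    · exact Or.inr h.symm
  have ha' : Squarefree (a : ℤ) := Int.squarefree_natCast.2 ha
  rcases key with h | h
  · refine ⟨a, b / q.den, ha', div_ne_zero hb hden, ?_⟩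
    rw [← h] at hq'
    field_simp
    push_cast at hq' ⊢
    linarith
  · refine ⟨-a, b / q.den, Int.squarefree_natAbs.1 (by simpa using ha), div_ne_zero hb hden, ?_⟩
    rw [← h] at hq'
    field_simp
    push_cast at hq' ⊢
    linarith

/-- The square root of the discriminant of three elements changes by the sign of a permutation. -/
theorem prod_sub_perm {F : Type*} [Field F] (θ : Fin 3 → F) (c : Equiv.Perm (Fin 3)) :
    (θ (c 0) - θ (c 1)) * (θ (c 1) - θ (c 2)) * (θ (c 2) - θ (c 0)) =
      ((Equiv.Perm.sign c : ℤ) : F) * ((θ 0 - θ 1) * (θ 1 - θ 2) * (θ 2 - θ 0)) := by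
  rcases Int.units_eq_one_or (Equiv.Perm.sign c) with h | h
  · rw [h]
    rcases (perm3_sign_eq_one_iff c).1 h with rfl | ⟨h0, h1, h2⟩ | ⟨h0, h1, h2⟩
    · simp
    · rw [h0, h1, h2]; push_cast; ring
    · rw [h0, h1, h2]; push_cast; ring
  · rw [h]
    rcases (perm3_sign_eq_neg_one_iff c).1 h with ⟨h0, h1, h2⟩ | ⟨h0, h1, h2⟩ | ⟨h0, h1, h2⟩ <;>
    · rw [h0, h1, h2]; push_cast; ring

/-- The Lagrange resolvent of three elements with respect to a cube root of unity. -/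
def lagrangeResolvent {F : Type*} [Field F] (ω : F) (θ : Fin 3 → F) : F :=
  θ 0 + ω * θ 1 + ω ^ 2 * θ 2

/-- An even permutation multiplies the two Lagrange resolvents by inverse cube roots of unity. -/
theorem lagrangeResolvent_perm_of_sign_eq_one {F : Type*} [Field F] {ω : F}
    (hω : ω ^ 2 + ω + 1 = 0) (θ : Fin 3 → F) {c : Equiv.Perm (Fin 3)} (hc : Equiv.Perm.sign c = 1) :
    ∃ ζ : F, ζ ^ 3 = 1 ∧ lagrangeResolvent ω (θ ∘ c) = ζ * lagrangeResolvent ω θ ∧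
      lagrangeResolvent (ω ^ 2) (θ ∘ c) = ζ ^ 2 * lagrangeResolvent (ω ^ 2) θ ∧
      (ζ = 1 → ω = 1 ∨ c = 1) := by
  have h3 : ω ^ 3 = 1 := by linear_combination (ω - 1) * hω
  rcases (perm3_sign_eq_one_iff c).1 hc with rfl | ⟨h0, h1, h2⟩ | ⟨h0, h1, h2⟩
  · exact ⟨1, by simp⟩
  · refine ⟨ω ^ 2, by linear_combination (ω ^ 3 + 1) * h3, ?_, ?_, fun h => Or.inl ?_⟩
    · simp only [lagrangeResolvent, Function.comp_apply, h0, h1, h2]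
      linear_combination (-θ 1 - ω * θ 2) * h3
    · simp only [lagrangeResolvent, Function.comp_apply, h0, h1, h2]
      linear_combination (-(ω ^ 3 + 1) * θ 1 - ω ^ 2 * (ω ^ 3 + 1) * θ 2) * h3
    · linear_combination h3 - ω * h
  · refine ⟨ω, h3, ?_, ?_, fun h => Or.inl h⟩
    · simp only [lagrangeResolvent, Function.comp_apply, h0, h1, h2]
      linear_combination (- θ 2) * h3
    · simp only [lagrangeResolvent, Function.comp_apply, h0, h1, h2]
      linear_combination (-(ω ^ 3 + 1) * θ 2) * h3

/-- An odd permutation exchanges the two Lagrange resolvents, up to inverse cube roots of unity. -/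
theorem lagrangeResolvent_perm_of_sign_eq_neg_one {F : Type*} [Field F] {ω : F}
    (hω : ω ^ 2 + ω + 1 = 0) (θ : Fin 3 → F) {c : Equiv.Perm (Fin 3)}
    (hc : Equiv.Perm.sign c = -1) :
    ∃ ζ : F, ζ ^ 3 = 1 ∧ lagrangeResolvent ω (θ ∘ c) = ζ * lagrangeResolvent (ω ^ 2) θ ∧
      lagrangeResolvent (ω ^ 2) (θ ∘ c) = ζ ^ 2 * lagrangeResolvent ω θ := by
  have h3 : ω ^ 3 = 1 := by linear_combination (ω - 1) * hω
  rcases (perm3_sign_eq_neg_one_iff c).1 hc with ⟨h0, h1, h2⟩ | ⟨h0, h1, h2⟩ | ⟨h0, h1, h2⟩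
  · refine ⟨1, by simp, ?_, ?_⟩
    · simp only [lagrangeResolvent, Function.comp_apply, h0, h1, h2]
      linear_combination (-ω * θ 2) * h3
    · simp only [lagrangeResolvent, Function.comp_apply, h0, h1, h2]
      linear_combination (ω * θ 1) * h3
  · refine ⟨ω, h3, ?_, ?_⟩
    · simp only [lagrangeResolvent, Function.comp_apply, h0, h1, h2]
      linear_combination (-θ 1 - ω ^ 2 * θ 2) * h3
    · simp only [lagrangeResolvent, Function.comp_apply, h0, h1, h2]
      linear_combination (-θ 1) * h3
  · refine ⟨ω ^ 2, by linear_combination (ω ^ 3 + 1) * h3, ?_, ?_⟩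
    · simp only [lagrangeResolvent, Function.comp_apply, h0, h1, h2]
      linear_combination (-ω * θ 1 - (ω ^ 3 + 1) * θ 2) * h3
    · simp only [lagrangeResolvent, Function.comp_apply, h0, h1, h2]
      linear_combination (-ω ^ 2 * θ 1 - (ω ^ 3 + 1) * θ 2) * h3

/-! ### Cube roots of unity and quadratic subfields -/

theorem exists_primitive_cubeRoot : ∃ ω : Ω, ω ^ 2 + ω + 1 = 0 := by
  obtain ⟨ω, hω⟩ := IsAlgClosed.exists_root (X ^ 2 + X + 1 : Polynomial Ω) (by
    have : (X ^ 2 + X + 1 : Polynomial Ω).degree = 2 := by compute_degree!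
    rw [this]; norm_num)
  exact ⟨ω, by simpa using hω⟩

theorem isIntegral_of_primitive_cubeRoot {ω : Ω} (hω : ω ^ 2 + ω + 1 = 0) : IsIntegral ℤ ω :=
  .of_pow (n := 3) (by norm_num) (by
    rw [show ω ^ 3 = 1 by linear_combination (ω - 1) * hω]; exact isIntegral_one)

theorem algEquiv_primitive_cubeRoot (σ : GQ) {ω : Ω} (hω : ω ^ 2 + ω + 1 = 0) :
    σ ω = ω ∨ σ ω = ω ^ 2 := by
  have h := congrArg σ hω
  simp only [map_add, map_pow, map_one, map_zero] at h
  have : (σ ω - ω) * (σ ω - ω ^ 2) = 0 := by linear_combination h + (ω - 1 - σ ω) * hω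
  exact (mul_eq_zero.1 this).imp sub_eq_zero.1 sub_eq_zero.1

/-- A cube root of unity congruent to `1` modulo a prime not above `3` is `1`. -/
theorem eq_one_of_sub_one_mem {p : ℕ} [Fact p.Prime] (hp : p ≠ 3) {P : Ideal (𝓞 Ω)} [P.IsPrime]
    [P.LiesOver (Ideal.span {(p : ℤ)})] {ν : 𝓞 Ω} (hν : ν ^ 3 = 1) (h : ν - 1 ∈ P) : ν = 1 := by
  by_contra hne
  have h0 : ν ^ 2 + ν + 1 = 0 := by
    refine (mul_eq_zero.1 (?_ : (ν - 1) * (ν ^ 2 + ν + 1) = 0)).resolve_left (sub_ne_zero.2 hne)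
    linear_combination hν
  have h3 : ((3 : ℤ) : 𝓞 Ω) ∈ P := by
    have : ((3 : ℤ) : 𝓞 Ω) = -(ν + 2) * (ν - 1) := by push_cast; linear_combination h0
    rw [this]
    exact P.mul_mem_left _ h
  rw [intCast_mem_iff_of_liesOver (p := p)] at h3
  exact hp ((Nat.prime_dvd_prime_iff_eq Fact.out Nat.prime_three).1 (by exact_mod_cast h3))

theorem eq_of_sub_mem_of_cubeRoot {p : ℕ} [Fact p.Prime] (hp : p ≠ 3) {P : Ideal (𝓞 Ω)} [P.IsPrime]
    [P.LiesOver (Ideal.span {(p : ℤ)})] {w : 𝓞 Ω} (hw : w ^ 2 + w + 1 = 0) {σ : GQ}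
    (h : σ • w - w ∈ P) : σ • w = w := by
  have h3 : w ^ 3 = 1 := by linear_combination (w - 1) * hw
  have hw' : algebraMap (𝓞 Ω) Ω w ^ 2 + algebraMap (𝓞 Ω) Ω w + 1 = 0 := by
    simpa using congrArg (algebraMap (𝓞 Ω) Ω) hw
  rcases algEquiv_primitive_cubeRoot σ hw' with h1 | h1
  · exact RingOfIntegers.coe_injective h1
  · have h2 : σ • w = w ^ 2 := RingOfIntegers.coe_injective (by rw [map_pow]; exact h1)
    have h4 : w - 1 ∈ P := by
      have := P.mul_mem_left (w ^ 2) h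
      rw [h2] at this
      convert this using 1
      linear_combination (1 - w) * h3
    have := eq_one_of_sub_one_mem hp h3 h4
    rw [h2, this, one_pow]

theorem inertia_primitive_cubeRoot {p : ℕ} [Fact p.Prime] (hp : p ≠ 3) {P : Ideal (𝓞 Ω)} [P.IsPrime]
    [P.LiesOver (Ideal.span {(p : ℤ)})] {σ : GQ} (hσ : σ ∈ P.inertia GQ) {ω : Ω}
    (hω : ω ^ 2 + ω + 1 = 0) : σ ω = ω := by
  let w : 𝓞 Ω := ⟨ω, isIntegral_of_primitive_cubeRoot hω⟩
  have hw : w ^ 2 + w + 1 = 0 := RingOfIntegers.coe_injective hω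
  exact congrArg (algebraMap (𝓞 Ω) Ω) (eq_of_sub_mem_of_cubeRoot hp hw (hσ w))

/-- The field cut out by `s`, with a primitive cube root of unity adjoined, is unramified
outside `6` when `s` is. -/
theorem exists_unramified_field (s : GQ →* Equiv.Perm (Fin 3)) (hs : IsOpen (s.ker : Set GQ))
    (hur : ∀ p : ℕ, p.Prime → p ≠ 2 → p ≠ 3 → ∀ P : Ideal (𝓞 Ω), P.IsPrime →
      P.LiesOver (Ideal.span {(p : ℤ)}) → P.inertia GQ ≤ s.ker)
    {ω : Ω} (hω : ω ^ 2 + ω + 1 = 0) :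
    ∃ M : IntermediateField ℚ Ω, IsGalois ℚ M ∧ FiniteDimensional ℚ M ∧
      (∀ p : ℕ, p.Prime → p ≠ 2 → p ≠ 3 → ∀ P : Ideal (𝓞 Ω), P.IsPrime →
        P.LiesOver (Ideal.span {(p : ℤ)}) → P.inertia GQ ≤ M.fixingSubgroup) ∧
      ∀ x, (∀ σ ∈ s.ker, σ ω = ω → σ x = x) → x ∈ M := by
  let U : Subgroup GQ := s.ker ⊓ MulAction.stabilizer GQ ω
  have hUn : U.Normal := by
    refine ⟨fun n hn g => ⟨s.normal_ker.conj_mem n hn.1 g, ?_⟩⟩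
    have hn2 : n ω = ω := hn.2
    have h1 : n (g⁻¹ ω) = g⁻¹ ω := by
      rcases algEquiv_primitive_cubeRoot g⁻¹ hω with h | h <;> rw [h]
      · exact hn2
      · rw [map_pow, hn2]
    change g (n (g⁻¹ ω)) = ω
    rw [h1]
    exact g.apply_symm_apply ω
  have hUo : IsOpen (U : Set GQ) := hs.inter (stabilizer_isOpen_of_isIntegral ω)
  obtain ⟨M, h1, h2, h3, h4⟩ := exists_fixingSubgroup_eq U hUo
  refine ⟨M, h1, h2, fun p hp hp2 hp3 P hP hPp σ hσ => ?_, fun x hx => h4 x fun σ hσ =>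
    hx σ hσ.1 hσ.2⟩
  rw [h3]
  have : Fact p.Prime := ⟨hp⟩
  exact ⟨hur p hp hp2 hp3 P hP hPp hσ, inertia_primitive_cubeRoot hp3 hσ hω⟩

/-- A squarefree integer with a square root in a Galois extension unramified outside `6` divides
`6`. -/
theorem natAbs_dvd_six {M : IntermediateField ℚ Ω} [IsGalois ℚ M] [FiniteDimensional ℚ M]
    (hM : ∀ p : ℕ, p.Prime → p ≠ 2 → p ≠ 3 → ∀ P : Ideal (𝓞 Ω), P.IsPrime →
        P.LiesOver (Ideal.span {(p : ℤ)}) → P.inertia GQ ≤ M.fixingSubgroup)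
    {d : ℤ} (hd : Squarefree d) {δ : Ω} (hδ : δ ^ 2 = d) (hδM : δ ∈ M) : d.natAbs ∣ 6 := by
  rw [← Nat.prod_primeFactors_of_squarefree (Int.squarefree_natAbs.2 hd),
    show 6 = ∏ p ∈ ({2, 3} : Finset ℕ), p by simp]
  refine Finset.prod_dvd_prod_of_subset _ _ _ fun p hp => ?_
  by_contra hp'
  simp only [Finset.mem_insert, Finset.mem_singleton, not_or] at hp'
  have hpp := Nat.prime_of_mem_primeFactors hp
  have : Fact p.Prime := ⟨hpp⟩
  obtain ⟨u, hu⟩ := Int.natCast_dvd.2 (Nat.dvd_of_mem_primeFactors hp)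
  have hpu : ¬ (p : ℤ) ∣ u := fun ⟨v, hv⟩ =>
    (Nat.prime_iff_prime_int.1 hpp).not_isUnit (hd p ⟨v, by rw [hu, hv]; ring⟩)
  have := dvd_of_map_eq_pow_of_inertia_le (Int.castRingHom Ω) Int.cast_injective M
    (hM p hpp hp'.1 hp'.2) (fun x => by simp) hδM (Nat.prime_iff_prime_int.1 hpp)
    (by simp) (a := d) (k := 1) (n := 2) (by rw [pow_one]; exact hu) hpu two_ne_zero (by simp [hδ])
  omega

/-- Euler's criterion, read off from the Frobenius action on a square root of `d`; the factor `d`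
allows for `p ∣ d`. -/
theorem dvd_of_frob_fixes {p : ℕ} [Fact p.Prime] {P : Ideal (𝓞 Ω)} [P.IsPrime]
    [P.LiesOver (Ideal.span {(p : ℤ)})] {σ : GQ} (hσ : IsArithFrobAt ℤ σ P) {d : ℤ} {δ : Ω}
    (hδ : δ ^ 2 = d) (hσδ : σ δ = δ) {m : ℕ} (hm : p = 2 * m + 1) :
    (p : ℤ) ∣ d * (d ^ m - 1) := by
  have hint : IsIntegral ℤ δ := .of_pow two_pos (hδ ▸ isIntegral_algebraMap (x := d))
  let w : 𝓞 Ω := ⟨δ, hint⟩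
  have hw : w ^ 2 = (d : 𝓞 Ω) := RingOfIntegers.coe_injective (by
    rw [map_pow, map_intCast]
    exact hδ)
  have h1 := (isArithFrobAt_iff (p := p)).1 hσ w
  rw [show σ • w = w from RingOfIntegers.coe_injective hσδ] at h1
  rw [← intCast_mem_iff_of_liesOver (P := P)]
  convert P.mul_mem_left (-w) h1 using 1
  push_cast
  rw [← hw, hm]
  ring

/-- Among the divisors of `6` up to sign, only `1` and `-6` are squares modulo `5` and `7`. -/
theorem cases_of_dvd_six {d : ℤ} (h : d.natAbs ∣ 6) (h5 : (5 : ℤ) ∣ d * (d ^ 2 - 1))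
    (h7 : (7 : ℤ) ∣ d * (d ^ 3 - 1)) : d = 1 ∨ d = -6 := by
  have hle : d.natAbs ≤ 6 := Nat.le_of_dvd (by norm_num) h
  have h1 : -6 ≤ d := by omega
  have h2 : d ≤ 6 := by omega
  interval_cases d <;> revert h h5 h7 <;> decide

/-! ### Kummer theory of Lagrange resolvents -/

theorem primitive_cubeRoot_ne_one {ω : Ω} (hω : ω ^ 2 + ω + 1 = 0) : ω ≠ 1 := by
  rintro rfl
  norm_num at hω

theorem sq_primitive_cubeRoot {F : Type*} [Field F] {ω : F} (hω : ω ^ 2 + ω + 1 = 0) :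
    (ω ^ 2) ^ 2 = ω := by
  linear_combination (ω ^ 2 - ω) * hω

theorem sq_apply_primitive_cubeRoot (σ : GQ) {ω : Ω} (hω : ω ^ 2 + ω + 1 = 0) :
    (σ ^ 2 : GQ) ω = ω := by
  rw [pow_two, AlgEquiv.mul_apply]
  rcases algEquiv_primitive_cubeRoot σ hω with h | h
  · rw [h, h]
  · rw [h, map_pow, h, sq_primitive_cubeRoot hω]

/-- An automorphism fixing `ω` fixes all cube roots of unity. -/
theorem apply_eq_of_cube_eq_one {σ : GQ} {ω ν : Ω} (hω : ω ^ 2 + ω + 1 = 0) (hσ : σ ω = ω)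
    (hν : ν ^ 3 = 1) : σ ν = ν := by
  have h : (ν - 1) * ((ν - ω) * (ν - ω ^ 2)) = 0 := by
    linear_combination hν + (-ν ^ 2 + ν * ω - (ω - 1)) * hω
  rcases mul_eq_zero.1 h with h | h
  · rw [sub_eq_zero.1 h, map_one]
  rcases mul_eq_zero.1 h with h | h
  · rw [sub_eq_zero.1 h, hσ]
  · rw [sub_eq_zero.1 h, map_pow, hσ]

theorem QuadraticAlgebra.injective_of_norm {a b : ℤ}
    (h0 : ∀ z : QuadraticAlgebra ℤ a b, z.norm = 0 → z = 0)
    (f : QuadraticAlgebra ℤ a b →+* Ω) : Function.Injective f := by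
  refine (injective_iff_map_eq_zero f).2 fun z hz => h0 z ?_
  have h : f (algebraMap ℤ _ z.norm) = 0 := by
    rw [algebraMap_norm_eq_mul_star, map_mul, hz, zero_mul]
  rw [eq_intCast, map_intCast] at h
  exact_mod_cast h

theorem map_lagrangeResolvent {s : GQ →* Equiv.Perm (Fin 3)} {θ : Fin 3 → Ω}
    (hθ : ∀ (σ : GQ) i, σ (θ i) = θ (s σ i)) (σ : GQ) (ω : Ω) :
    σ (lagrangeResolvent ω θ) = lagrangeResolvent (σ ω) (θ ∘ s σ) := by
  simp [lagrangeResolvent, hθ]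

theorem exists_lagrangeResolvent_ne_zero {θ : Fin 3 → Ω} (hinj : Function.Injective θ) :
    ∃ ω : Ω, ω ^ 2 + ω + 1 = 0 ∧ lagrangeResolvent ω θ ≠ 0 := by
  obtain ⟨ω, hω⟩ := exists_primitive_cubeRoot
  by_contra! h
  have h1 := h ω hω
  have h2 := h (ω ^ 2) (by rw [sq_primitive_cubeRoot hω]; linear_combination hω)
  simp only [lagrangeResolvent, sq_primitive_cubeRoot hω] at h1 h2
  have h3 : ω * (1 - ω) * (θ 1 - θ 2) = 0 := by linear_combination h1 - h2
  have h0 : ω ≠ 0 := by rintro rfl; norm_num at hω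
  have h4 : θ 1 = θ 2 := sub_eq_zero.1 <| (mul_eq_zero.1 h3).resolve_left <|
    mul_ne_zero h0 (sub_ne_zero.2 (primitive_cubeRoot_ne_one hω).symm)
  exact absurd (hinj h4) (by decide)

theorem perm_eq_one_of_fixes_lagrangeResolvent {s : GQ →* Equiv.Perm (Fin 3)} {θ : Fin 3 → Ω}
    (hθ : ∀ (σ : GQ) i, σ (θ i) = θ (s σ i)) {ω : Ω} (hω : ω ^ 2 + ω + 1 = 0)
    (h0 : lagrangeResolvent ω θ ≠ 0) {σ : GQ} (hσω : σ ω = ω)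
    (hσ : Equiv.Perm.sign (s σ) = 1)
    (h : σ (lagrangeResolvent ω θ) = lagrangeResolvent ω θ) : s σ = 1 := by
  obtain ⟨ζ, -, h1, -, h2⟩ := lagrangeResolvent_perm_of_sign_eq_one hω θ hσ
  rw [map_lagrangeResolvent hθ, hσω, h1] at h
  exact (h2 (mul_right_cancel₀ h0 (h.trans (one_mul _).symm))).resolve_left
    (primitive_cubeRoot_ne_one hω)

/-- The Galois action on the pair of Lagrange resolvents: up to cube roots of unity, they are fixed
or swapped according to the action on `τ`, where `τ * √-3` is a square root of the discriminant up
to a rational factor. -/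
theorem map_lagrangeResolvents {s : GQ →* Equiv.Perm (Fin 3)} {θ : Fin 3 → Ω}
    (hθ : ∀ (σ : GQ) i, σ (θ i) = θ (s σ i)) {ω τ : Ω} (hω : ω ^ 2 + ω + 1 = 0)
    (hτ : ∀ σ : GQ, σ (τ * (2 * ω + 1)) = ((Equiv.Perm.sign (s σ) : ℤ) : Ω) * (τ * (2 * ω + 1)))
    (σ : GQ) :
    (σ τ = τ ∧ ∃ ζ : Ω, ζ ^ 3 = 1 ∧
      σ (lagrangeResolvent ω θ) = ζ * lagrangeResolvent ω θ ∧
      σ (lagrangeResolvent (ω ^ 2) θ) = ζ ^ 2 * lagrangeResolvent (ω ^ 2) θ) ∨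
    (σ τ = -τ ∧ ∃ ζ : Ω, ζ ^ 3 = 1 ∧
      σ (lagrangeResolvent ω θ) = ζ * lagrangeResolvent (ω ^ 2) θ ∧
      σ (lagrangeResolvent (ω ^ 2) θ) = ζ ^ 2 * lagrangeResolvent ω θ) := by
  have hne : 2 * ω + 1 ≠ 0 := fun h => by
    have : (2 * ω + 1) ^ 2 = -3 := by linear_combination 4 * hω
    rw [h] at this
    norm_num at this
  have h4 := sq_primitive_cubeRoot hω
  have h := hτ σ
  rw [map_mul, map_add, map_mul, map_ofNat, map_one] at h
  rw [map_lagrangeResolvent hθ, map_lagrangeResolvent hθ, map_pow]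
  rcases algEquiv_primitive_cubeRoot σ hω with h1 | h1 <;>
    rcases Int.units_eq_one_or (Equiv.Perm.sign (s σ)) with h2 | h2 <;> rw [h1, h2] at h <;>
    rw [h1]
  · obtain ⟨ζ, hζ, h5, h6, -⟩ := lagrangeResolvent_perm_of_sign_eq_one hω θ h2
    refine Or.inl ⟨mul_right_cancel₀ hne (h.trans ?_), ζ, hζ, h5, h6⟩
    push_cast
    ring
  · obtain ⟨ζ, hζ, h5, h6⟩ := lagrangeResolvent_perm_of_sign_eq_neg_one hω θ h2
    refine Or.inr ⟨mul_right_cancel₀ hne (h.trans ?_), ζ, hζ, h5, h6⟩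
    push_cast
    ring
  · obtain ⟨ζ, hζ, h5, h6, -⟩ := lagrangeResolvent_perm_of_sign_eq_one hω θ h2
    refine Or.inr ⟨mul_right_cancel₀ hne ?_, ζ ^ 2,
      by rw [← pow_mul, mul_comm, pow_mul, hζ, one_pow], h6, ?_⟩
    · push_cast at h
      linear_combination -h + 2 * σ τ * hω
    · rw [h4, h5]
      linear_combination -(lagrangeResolvent ω θ) * ζ * hζ
  · obtain ⟨ζ, hζ, h5, h6⟩ := lagrangeResolvent_perm_of_sign_eq_neg_one hω θ h2
    refine Or.inl ⟨mul_right_cancel₀ hne ?_, ζ ^ 2,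
      by rw [← pow_mul, mul_comm, pow_mul, hζ, one_pow], h6, ?_⟩
    · push_cast at h
      linear_combination -h + 2 * σ τ * hω
    · rw [h4, h5]
      linear_combination -(lagrangeResolvent (ω ^ 2) θ) * ζ * hζ

theorem exists_int_eq_of_cube_eq {q : ℚ} {m : ℤ} (h : q ^ 3 = m) : ∃ r : ℤ, (r : ℚ) = q := by
  have : IsIntegral ℤ q := .of_pow (n := 3) (by norm_num) (h ▸ isIntegral_algebraMap (x := m))
  obtain ⟨r, hr⟩ := IsIntegrallyClosed.isIntegral_iff.1 this
  exact ⟨r, by simpa using hr⟩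

/-- After scaling, the cube of a Lagrange resolvent `b` is an integral combination of `1` and `τ`
whose norm is the cube of an integer: the Galois group fixes or swaps `b ^ 3` and `c ^ 3` as it does
`τ` and `-τ`, and it fixes `b * c`. -/
theorem exists_cube_eq {b c τ : Ω} {D : ℤ} (hτ : τ ^ 2 = D) (hτ0 : τ ≠ 0)
    (h : ∀ σ : GQ, (σ τ = τ ∧ ∃ ζ : Ω, ζ ^ 3 = 1 ∧ σ b = ζ * b ∧ σ c = ζ ^ 2 * c) ∨
      (σ τ = -τ ∧ ∃ ζ : Ω, ζ ^ 3 = 1 ∧ σ b = ζ * c ∧ σ c = ζ ^ 2 * b)) :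
    ∃ n x y r : ℤ, n ≠ 0 ∧ (n * b) ^ 3 = x + y * τ ∧ x ^ 2 - D * y ^ 2 = r ^ 3 := by
  obtain ⟨u, hu⟩ := exists_rat_of_forall_fixed ((b ^ 3 + c ^ 3) / 2) fun σ => by
    rcases h σ with ⟨-, ζ, hζ, h1, h2⟩ | ⟨-, ζ, hζ, h1, h2⟩ <;>
    · rw [map_div₀, map_add, map_pow, map_pow, h1, h2, map_ofNat, mul_pow, mul_pow, ← pow_mul,
        mul_comm 2 3, pow_mul, hζ]
      ring
  obtain ⟨v, hv⟩ := exists_rat_of_forall_fixed ((b ^ 3 - c ^ 3) / (2 * τ)) fun σ => by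
    rcases h σ with ⟨h0, ζ, hζ, h1, h2⟩ | ⟨h0, ζ, hζ, h1, h2⟩
    · rw [map_div₀, map_sub, map_pow, map_pow, map_mul, h1, h2, h0, map_ofNat, mul_pow, mul_pow,
        ← pow_mul, mul_comm 2 3, pow_mul, hζ]
      field_simp
    · rw [map_div₀, map_sub, map_pow, map_pow, map_mul, h1, h2, h0, map_ofNat, mul_pow, mul_pow,
        ← pow_mul, mul_comm 2 3, pow_mul, hζ]
      field_simp
      ring
  obtain ⟨w, hw⟩ := exists_rat_of_forall_fixed (b * c) fun σ => by
    rcases h σ with ⟨-, ζ, hζ, h1, h2⟩ | ⟨-, ζ, hζ, h1, h2⟩ <;>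
    · rw [map_mul, h1, h2]
      linear_combination (b * c) * hζ
  have hb : b ^ 3 = u + v * τ := by
    rw [hu, hv]; field_simp; ring
  have hc : c ^ 3 = u - v * τ := by
    rw [hu, hv]; field_simp; ring
  have hnorm : u ^ 2 - D * v ^ 2 = w ^ 3 := by
    have : ((u ^ 2 - D * v ^ 2 : ℚ) : Ω) = ((w ^ 3 : ℚ) : Ω) := by
      push_cast
      rw [hw, mul_pow, hb, hc, ← hτ]
      ring
    exact_mod_cast this
  obtain ⟨n, hn⟩ : ∃ n : ℤ, n = u.den * v.den := ⟨_, rfl⟩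
  have hn0 : n ≠ 0 := by simp [hn]
  obtain ⟨x, hx⟩ : ∃ x : ℤ, (x : ℚ) = n ^ 3 * u := ⟨u.num * v.den * n ^ 2, by
    rw [hn]; push_cast
    rw [← Rat.mul_den_eq_num u]; ring⟩
  obtain ⟨y, hy⟩ : ∃ y : ℤ, (y : ℚ) = n ^ 3 * v := ⟨v.num * u.den * n ^ 2, by
    rw [hn]; push_cast
    rw [← Rat.mul_den_eq_num v]; ring⟩
  have hxy : ((n : ℚ) ^ 2 * w) ^ 3 = ((x ^ 2 - D * y ^ 2 : ℤ) : ℚ) := by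
    push_cast
    rw [hx, hy]
    linear_combination -(n : ℚ) ^ 6 * hnorm
  obtain ⟨r, hr⟩ := exists_int_eq_of_cube_eq hxy
  refine ⟨n, x, y, r, hn0, ?_, by rw [← hr] at hxy; exact_mod_cast hxy.symm⟩
  have hx' := congrArg (Rat.cast : ℚ → Ω) hx
  have hy' := congrArg (Rat.cast : ℚ → Ω) hy
  rw [Rat.cast_intCast] at hx' hy'
  rw [hx', hy', mul_pow, hb]
  push_cast
  ring

theorem exists_prime_natCast_dvd {a b : ℤ} {π : QuadraticAlgebra ℤ a b} (hπ : Prime π)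
    (h0 : π.norm ≠ 0) : ∃ p : ℕ, p.Prime ∧ π ∣ (p : QuadraticAlgebra ℤ a b) := by
  have h1 : π ∣ ((π.norm.natAbs : ℕ) : QuadraticAlgebra ℤ a b) := by
    have h2 : π ∣ ((π.norm : ℤ) : QuadraticAlgebra ℤ a b) :=
      ⟨star π, by rw [← QuadraticAlgebra.algebraMap_norm_eq_mul_star]; rfl⟩
    rcases Int.natAbs_eq π.norm with h | h <;> rw [h] at h2 <;> simpa using h2
  rw [← Nat.prod_primeFactorsList (Int.natAbs_ne_zero.2 h0), Nat.cast_list_prod,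
    Prime.dvd_prod_iff hπ] at h1
  obtain ⟨x, hx, hπx⟩ := h1
  obtain ⟨p, hp, rfl⟩ := List.mem_map.1 hx
  exact ⟨p, Nat.prime_of_mem_primeFactorsList hp, hπx⟩

/-- If a cube root of `α` lies in a Galois extension of `ℚ` unramified outside `6`, and the norm of
`α` is a cube, then `α` is a cube up to a unit. -/
theorem exists_isUnit_mul_cube_of_mem {a b : ℤ} [IsDomain (QuadraticAlgebra ℤ a b)]
    [IsPrincipalIdealRing (QuadraticAlgebra ℤ a b)]
    (h0 : ∀ z : QuadraticAlgebra ℤ a b, z.norm = 0 → z = 0)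
    (hp : ∀ p : ℕ, p = 2 ∨ p = 3 → ∃ π : QuadraticAlgebra ℤ a b,
      (π.norm.natAbs = p ∨ π.norm.natAbs = p ^ 2) ∧
        ∀ x : QuadraticAlgebra ℤ a b, (p : ℤ) ∣ x.norm → π ∣ x)
    (f : QuadraticAlgebra ℤ a b →+* Ω) (hf : Function.Injective f)
    {M : IntermediateField ℚ Ω} [IsGalois ℚ M] [FiniteDimensional ℚ M]
    (hM : ∀ p : ℕ, p.Prime → p ≠ 2 → p ≠ 3 → ∀ P : Ideal (𝓞 Ω), P.IsPrime →
        P.LiesOver (Ideal.span {(p : ℤ)}) → P.inertia GQ ≤ M.fixingSubgroup)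
    (hfM : ∀ x, f x ∈ M) {β : Ω} (hβ : β ∈ M)
    {α : QuadraticAlgebra ℤ a b} (hα : α ≠ 0) (hαβ : f α = β ^ 3)
    {r : ℤ} (hr : α.norm = r ^ 3) : ∃ u c, IsUnit u ∧ α = u * c ^ 3 := by
  refine QuadraticAlgebra.exists_isUnit_mul_cube hp hα hr fun π hπ h6 k u hk hu => ?_
  obtain ⟨p, hpp, hπp⟩ := exists_prime_natCast_dvd hπ fun h => hπ.ne_zero (h0 π h)
  have : Fact p.Prime := ⟨hpp⟩
  have hp2 : p ≠ 2 := by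
    rintro rfl
    exact h6 (hπp.trans ⟨3, by norm_num⟩)
  have hp3 : p ≠ 3 := by
    rintro rfl
    exact h6 (hπp.trans ⟨2, by norm_num⟩)
  exact dvd_of_map_eq_pow_of_inertia_le f hf M (hM p hpp hp2 hp3) hfM hβ hπ hπp hk hu
    three_ne_zero hαβ

/-! ### Cyclic cubic fields unramified outside `6` -/

/-- There is no cyclic cubic field unramified outside `6` in which `13` splits. The Lagrange
resolvent of such a field is a multiple, by an element of `ℚ(ω)`, of an eighteenth root of unity
`η`. A Frobenius element at `13` fixes `η`, so `η ^ 12 = 1` and thus `η ^ 6 = 1`. Hence `η`, and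
with it the cubic field, lies in the quadratic field `ℚ(ω)`, which is absurd. -/
theorem not_forall_sign_eq_one (s : GQ →* Equiv.Perm (Fin 3)) (hs : IsOpen (s.ker : Set GQ))
    (hur : ∀ p : ℕ, p.Prime → p ≠ 2 → p ≠ 3 → ∀ P : Ideal (𝓞 Ω), P.IsPrime →
      P.LiesOver (Ideal.span {(p : ℤ)}) → P.inertia GQ ≤ s.ker)
    {γ : GQ} (hγ : ∀ i, s γ i ≠ i)
    (h13 : ∀ P : Ideal (𝓞 Ω), P.IsPrime → P.LiesOver (Ideal.span {((13 : ℕ) : ℤ)}) →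
      ∀ σ : GQ, IsArithFrobAt ℤ σ P → ∃ i, s σ i = i)
    (hsign : ∀ σ, Equiv.Perm.sign (s σ) = 1) : False := by
  obtain ⟨θ, hinj, hθ⟩ := exists_equivariant s hs hγ
  obtain ⟨ω, hω, hβ0⟩ := exists_lagrangeResolvent_ne_zero hinj
  obtain ⟨M, _, _, hM, hmem⟩ := exists_unramified_field s hs hur hω
  have hω3 : ω ^ 3 = 1 := by linear_combination (ω - 1) * hω
  have hτ2 : (2 * ω + 1) ^ 2 = ((-3 : ℤ) : Ω) := by push_cast; linear_combination 4 * hω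
  have hτ0 : 2 * ω + 1 ≠ 0 := fun h => by rw [h] at hτ2; norm_num at hτ2
  obtain ⟨n, x, y, r, hn, hcube, hr⟩ := exists_cube_eq hτ2 hτ0
    (map_lagrangeResolvents hθ hω fun σ => by
      rw [hsign σ, map_mul, map_add, map_mul, map_ofNat, map_one]
      rcases algEquiv_primitive_cubeRoot σ hω with h | h <;> rw [h]
      · simp
      · push_cast
        linear_combination (4 * (ω ^ 2 - ω)) * hω)
  have hn' : (n : Ω) ≠ 0 := by exact_mod_cast hn
  set β : Ω := n * lagrangeResolvent ω θ with hβ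
  have hβ0' : β ≠ 0 := mul_ne_zero hn' hβ0
  have hfix (σ : GQ) (h1 : s σ = 1) (h2 : σ ω = ω) : σ β = β := by
    rw [hβ, map_mul, map_intCast, map_lagrangeResolvent hθ, h2, h1]
    rfl
  have hfix' (σ : GQ) (h2 : σ ω = ω) (h : σ β = β) : s σ = 1 := by
    refine perm_eq_one_of_fixes_lagrangeResolvent hθ hω hβ0 h2 (hsign σ) ?_
    rw [hβ, map_mul, map_intCast] at h
    exact mul_left_cancel₀ hn' h
  have hβM : β ∈ M := hmem β fun σ h1 h2 => hfix σ h1 h2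
  let f : Eisenstein →+* Ω := (QuadraticAlgebra.lift (R := ℤ) ⟨ω, by
    simp; linear_combination hω⟩ : Eisenstein →ₐ[ℤ] Ω).toRingHom
  have hf (z : Eisenstein) : f z = z.re + z.im * ω := by
    simp [f]
  have hfinj : Function.Injective f :=
    QuadraticAlgebra.injective_of_norm Eisenstein.eq_zero_of_norm_eq_zero f
  have hα : f ⟨x + y, 2 * y⟩ = β ^ 3 := by
    rw [hf, hcube]; push_cast; ring
  have hα0 : (⟨x + y, 2 * y⟩ : Eisenstein) ≠ 0 := by
    rintro h
    rw [h, map_zero] at hα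
    exact hβ0' (pow_eq_zero_iff (three_ne_zero)|>.1 hα.symm)
  obtain ⟨u, c, hu, hc⟩ := exists_isUnit_mul_cube_of_mem Eisenstein.eq_zero_of_norm_eq_zero
    Eisenstein.exists_prime_above f hfinj hM
    (fun z => by
      rw [hf]
      exact add_mem (intCast_mem M _) (mul_mem (intCast_mem M _) (hmem ω fun σ _ h => h)))
    hβM hα0 hα (r := r) (by rw [Eisenstein.norm_eq, ← hr]; ring)
  have hfc : f c ≠ 0 := by
    intro h
    rw [hc, map_mul, map_pow, h] at hα
    exact hβ0' (pow_eq_zero_iff (three_ne_zero)|>.1 (by rw [← hα]; ring))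
  have hfcfix (σ : GQ) (h : σ ω = ω) : σ (f c) = f c := by
    rw [hf, map_add, map_mul, h, map_intCast, map_intCast]
  -- `η ^ 3` is a unit of `ℤ[ω]`, so `η` is a root of unity of order dividing `18`.
  set η : Ω := β / f c with hη
  have hη3 : η ^ 3 = f u := by
    rw [hη, div_pow, ← hα, hc, map_mul, map_pow]
    field_simp
  have hη18 : η ^ 18 = 1 := by
    rw [show 18 = 3 * 6 by rfl, pow_mul, hη3, ← map_pow, Eisenstein.pow_six_eq_one_of_isUnit hu,
      map_one]
  have hηfix (σ : GQ) (h1 : s σ = 1) (h2 : σ ω = ω) : σ η = η := by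
    rw [hη, map_div₀, hfix σ h1 h2, hfcfix σ h2]
  have : Fact (Nat.Prime 13) := ⟨by norm_num⟩
  obtain ⟨P, hP, hPp⟩ := exists_liesOver 13
  obtain ⟨σ, hσ⟩ := exists_isArithFrobAt (p := 13) P
  obtain ⟨i, hi⟩ := h13 P hP hPp σ hσ
  have hσ1 : s σ = 1 := perm3_eq_one_of_sign_of_apply_eq _ (hsign σ) i hi
  have hfrob := (isArithFrobAt_iff (p := 13)).1 hσ
  have hσω : σ ω = ω := by
    let w : 𝓞 Ω := ⟨ω, isIntegral_of_primitive_cubeRoot hω⟩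
    have hw : w ^ 2 + w + 1 = 0 := RingOfIntegers.coe_injective hω
    have hw13 : w ^ 13 = w := by
      have : w ^ 3 = 1 := by linear_combination (w - 1) * hw
      rw [show 13 = 3 * 4 + 1 by rfl, pow_add, pow_mul, this, one_pow, one_mul, pow_one]
    have := hfrob w
    rw [hw13] at this
    exact congrArg (algebraMap (𝓞 Ω) Ω) (eq_of_sub_mem_of_cubeRoot (p := 13) (by norm_num) hw this)
  -- Frobenius at `13` fixes `η`, so the cube root of unity `η ^ 12` is `1` modulo `P`, hence `1`.
  have hη6 : η ^ 6 = 1 := by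
    have hint : IsIntegral ℤ η := .of_pow (n := 18) (by norm_num) (hη18 ▸ isIntegral_one)
    let e : 𝓞 Ω := ⟨η, hint⟩
    have he18 : e ^ 18 = 1 := RingOfIntegers.coe_injective (by rw [map_pow, map_one]; exact hη18)
    have h1 := hfrob e
    rw [show σ • e = e from RingOfIntegers.coe_injective (hηfix σ hσ1 hσω)] at h1
    have h2 : e ^ 12 - 1 ∈ P := by
      convert P.mul_mem_left (-e ^ 17) h1 using 1
      linear_combination (1 - e ^ 12) * he18
    have h3 : e ^ 12 = 1 := eq_one_of_sub_one_mem (p := 13) (by norm_num)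
      (by rw [← pow_mul, show 12 * 3 = 18 * 2 by rfl, pow_mul, he18, one_pow]) h2
    have h4 : η ^ 12 = 1 := by
      have := congrArg (algebraMap (𝓞 Ω) Ω) h3
      rwa [map_pow, map_one] at this
    rw [show 18 = 12 + 6 by rfl, pow_add, h4, one_mul] at hη18
    exact hη18
  -- Hence `η` lies in `ℚ(ω)`, and everything fixing `ω` has trivial image.
  have hηω (σ : GQ) (h : σ ω = ω) : σ η = η := by
    have h1 : (η ^ 3 - 1) * ((-η) ^ 3 - 1) = 0 := by linear_combination -hη6
    rcases mul_eq_zero.1 h1 with h1 | h1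
    · exact apply_eq_of_cube_eq_one hω h (sub_eq_zero.1 h1)
    · have := apply_eq_of_cube_eq_one hω h (sub_eq_zero.1 h1)
      rwa [map_neg, neg_inj] at this
  have hγ2 : s (γ ^ 2) = 1 := by
    have hγω := sq_apply_primitive_cubeRoot γ hω
    refine hfix' _ hγω ?_
    have : β = η * f c := by rw [hη, div_mul_cancel₀ _ hfc]
    rw [this, map_mul, hηω _ hγω, hfcfix _ hγω]
  rw [map_pow] at hγ2
  exact (perm3_sign_eq_one_of_forall_ne _ hγ).2 hγ2

/-! ### The field `K6` and sextic fields containing `√-6` -/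

theorem mem_rootSet_iff {x : Ω} :
    x ∈ (X ^ 3 + 3 * X - 2 : ℚ[X]).rootSet Ω ↔ x ^ 3 + 3 * x - 2 = 0 := by
  have h0 : (X ^ 3 + 3 * X - 2 : ℚ[X]) ≠ 0 := by
    intro h
    have := congrArg (eval 0) h
    norm_num at this
  rw [mem_rootSet]
  have h3 : aeval x (3 : ℚ[X]) = 3 := map_ofNat _ 3
  have h2 : aeval x (2 : ℚ[X]) = 2 := map_ofNat _ 2
  simp [h0, h2, h3]

theorem mem_fixingSubgroup_K6_iff {σ : GQ} :
    σ ∈ K6.fixingSubgroup ↔ ∀ x : Ω, x ^ 3 + 3 * x - 2 = 0 → σ x = x := by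
  rw [K6, IntermediateField.mem_fixingSubgroup_iff]
  have := IntermediateField.forall_mem_adjoin_smul_eq_self_iff ℚ
    (S := (X ^ 3 + 3 * X - 2 : ℚ[X]).rootSet Ω) σ
  simp only [mem_rootSet_iff] at this
  exact this

/-- Cardano's formula for `x³ + 3x - 2`. -/
theorem cardano {a b : Ω} (hab : a * b = -1) (h : a ^ 3 + b ^ 3 = 2) :
    (a + b) ^ 3 + 3 * (a + b) - 2 = 0 := by
  linear_combination h + 3 * (a + b) * hab

/-- An `S₃`-extension of `ℚ` unramified outside `6` with quadratic subfield `ℚ(√-6)` is contained in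
`K6`. Its Lagrange resolvent is a cube root of a unit of `ℤ[√2]` times an element of `ℚ(√2)`; the
units are generated by `-1` and `1 + √2`, and the cube roots of `1 + √2` give the roots of
`x³ + 3x - 2`. -/
theorem fixingSubgroup_K6_le_ker (s : GQ →* Equiv.Perm (Fin 3)) (hs : IsOpen (s.ker : Set GQ))
    (hur : ∀ p : ℕ, p.Prime → p ≠ 2 → p ≠ 3 → ∀ P : Ideal (𝓞 Ω), P.IsPrime →
      P.LiesOver (Ideal.span {(p : ℤ)}) → P.inertia GQ ≤ s.ker)
    {γ : GQ} (hγ : ∀ i, s γ i ≠ i)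
    {δ : Ω} (hδ : δ ^ 2 = -6)
    (hsign : ∀ σ : GQ, σ δ = ((Equiv.Perm.sign (s σ) : ℤ) : Ω) * δ) :
    K6.fixingSubgroup ≤ s.ker := by
  obtain ⟨θ, hinj, hθ⟩ := exists_equivariant s hs hγ
  obtain ⟨ω, hω, hβ0⟩ := exists_lagrangeResolvent_ne_zero hinj
  obtain ⟨M, _, _, hM, hmem⟩ := exists_unramified_field s hs hur hω
  have hω3 : ω ^ 3 = 1 := by linear_combination (ω - 1) * hω
  have hω3' : (2 * ω + 1) ^ 2 = -3 := by linear_combination 4 * hω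
  have hδ0 : δ ≠ 0 := by rintro rfl; norm_num at hδ
  -- `τ` is a square root of `2`.
  obtain ⟨τ, hτ⟩ : ∃ τ : Ω, τ = δ * (2 * ω + 1) / 3 := ⟨_, rfl⟩
  have hτδ : τ * (2 * ω + 1) = -δ := by
    rw [hτ]
    linear_combination δ / 3 * hω3'
  have hτ2 : τ ^ 2 = ((2 : ℤ) : Ω) := by
    rw [hτ, div_pow, mul_pow, hδ, hω3']
    norm_num
  have hτ0 : τ ≠ 0 := fun h => by rw [h] at hτ2; norm_num at hτ2
  obtain ⟨n, x, y, r, hn, hcube, hr⟩ := exists_cube_eq hτ2 hτ0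
    (map_lagrangeResolvents hθ hω fun σ => by
      rw [hτδ, map_neg, hsign, mul_neg])
  have hn' : (n : Ω) ≠ 0 := by exact_mod_cast hn
  set β : Ω := n * lagrangeResolvent ω θ with hβ
  have hβ0' : β ≠ 0 := mul_ne_zero hn' hβ0
  have hsign1 (σ : GQ) (h : σ δ = δ) : Equiv.Perm.sign (s σ) = 1 := by
    have h1 := hsign σ
    rw [h] at h1
    rcases Int.units_eq_one_or (Equiv.Perm.sign (s σ)) with h2 | h2
    · exact h2
    · rw [h2] at h1
      push_cast at h1
      exact absurd (by linear_combination h1 / 2) hδ0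
  have hδker (σ : GQ) (h : s σ = 1) : σ δ = δ := by
    rw [hsign, h]; simp
  have hfix (σ : GQ) (h1 : s σ = 1) (h2 : σ ω = ω) : σ β = β := by
    rw [hβ, map_mul, map_intCast, map_lagrangeResolvent hθ, h2, h1]
    rfl
  have hfix' (σ : GQ) (h2 : σ ω = ω) (h3 : Equiv.Perm.sign (s σ) = 1) (h : σ β = β) :
      s σ = 1 := by
    refine perm_eq_one_of_fixes_lagrangeResolvent hθ hω hβ0 h2 h3 ?_
    rw [hβ, map_mul, map_intCast] at h
    exact mul_left_cancel₀ hn' h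
  have hβM : β ∈ M := hmem β fun σ h1 h2 => hfix σ h1 h2
  have hτM : τ ∈ M := hmem τ fun σ h1 h2 => by
    rw [hτ, map_div₀, map_mul, map_add, map_mul, hδker σ h1, h2, map_ofNat, map_ofNat, map_one]
  let f : ZSqrtTwo →+* Ω := (QuadraticAlgebra.lift (R := ℤ) ⟨τ, by
    simp; linear_combination hτ2⟩ : ZSqrtTwo →ₐ[ℤ] Ω).toRingHom
  have hf (z : ZSqrtTwo) : f z = z.re + z.im * τ := by
    simp [f]
  have hfinj : Function.Injective f :=
    QuadraticAlgebra.injective_of_norm ZSqrtTwo.eq_zero_of_norm_eq_zero f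
  have hα : f ⟨x, y⟩ = β ^ 3 := by
    rw [hf, hcube]
  have hα0 : (⟨x, y⟩ : ZSqrtTwo) ≠ 0 := by
    rintro h
    rw [h, map_zero] at hα
    exact hβ0' (pow_eq_zero_iff (three_ne_zero)|>.1 hα.symm)
  obtain ⟨u, c, hu, hc⟩ := exists_isUnit_mul_cube_of_mem ZSqrtTwo.eq_zero_of_norm_eq_zero
    ZSqrtTwo.exists_prime_above f hfinj hM
    (fun z => by
      rw [hf]
      exact add_mem (intCast_mem M _) (mul_mem (intCast_mem M _) hτM))
    hβM hα0 hα (r := r) (by rw [ZSqrtTwo.norm_eq, ← hr])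
  have hfc : f c ≠ 0 := by
    intro h
    rw [hc, map_mul, map_pow, h] at hα
    exact hβ0' (pow_eq_zero_iff (three_ne_zero)|>.1 (by rw [← hα]; ring))
  have hfcfix (σ : GQ) (h : σ τ = τ) : σ (f c) = f c := by
    rw [hf, map_add, map_mul, h, map_intCast, map_intCast]
  -- `e` is a cube root of the fundamental unit `1 + √2`, and `e'` one of its conjugate `1 - √2`.
  obtain ⟨e, he⟩ := IsAlgClosed.exists_pow_nat_eq (1 + τ) (n := 3) (by norm_num)
  have h12 : (1 + τ) * (1 - τ) = -1 := by
    push_cast at hτ2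
    linear_combination -hτ2
  have he0 : e ≠ 0 := by
    rintro rfl
    rw [← he] at h12
    norm_num at h12
  obtain ⟨e', hee'⟩ : ∃ e' : Ω, e * e' = -1 := ⟨-e⁻¹, by field_simp⟩
  have he' : e' ^ 3 = 1 - τ := by
    refine mul_left_cancel₀ (pow_ne_zero 3 he0) ?_
    rw [← mul_pow, hee', he, h12]
    norm_num
  have hη : ∃ η : Ω, β = η * f c ∧ ∀ σ : GQ, σ ω = ω → σ e = e → σ η = η := by
    obtain ⟨m, hm⟩ := ZSqrtTwo.exists_zpow_of_isUnit f hu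
    rw [show f ⟨1, 1⟩ = e ^ 3 by rw [hf, he]; push_cast; ring] at hm
    have key (κ : Ω) (hκ : κ ≠ 0) (hκf : f u = κ ^ 3)
        (hκσ : ∀ σ : GQ, σ ω = ω → σ e = e → σ κ = κ) :
        ∃ η : Ω, β = η * f c ∧ ∀ σ : GQ, σ ω = ω → σ e = e → σ η = η := by
      have h1 : (β / (κ * f c)) ^ 3 = 1 := by
        rw [div_pow, ← hα, hc, map_mul, map_pow, hκf, mul_pow]
        exact div_self (mul_ne_zero (pow_ne_zero 3 hκ) (pow_ne_zero 3 hfc))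
      refine ⟨β / (κ * f c) * κ, by field_simp, fun σ h2 h3 => ?_⟩
      rw [map_mul, apply_eq_of_cube_eq_one hω h2 h1, hκσ σ h2 h3]
    rcases hm with hm | hm
    · refine key (e ^ m) (zpow_ne_zero m he0) ?_ fun σ _ h => by rw [map_zpow₀, h]
      rw [hm, ← zpow_natCast, ← zpow_natCast, ← zpow_mul, ← zpow_mul, mul_comm]
    · refine key (-e ^ m) (neg_ne_zero.2 (zpow_ne_zero m he0)) ?_
        fun σ _ h => by rw [map_neg, map_zpow₀, h]
      rw [hm, Odd.neg_pow (by decide), ← zpow_natCast, ← zpow_natCast, ← zpow_mul, ← zpow_mul,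
        mul_comm]
  obtain ⟨η, hηβ, hησ⟩ := hη
  have hker (σ : GQ) (h1 : σ ω = ω) (h2 : σ e = e) : s σ = 1 := by
    have hσ3 : σ τ = τ := by
      have := congrArg σ he
      rw [map_pow, h2, he, map_add, map_one] at this
      exact (add_left_cancel this).symm
    refine hfix' σ h1 (hsign1 σ ?_) ?_
    · have h := congrArg σ hτδ
      rw [map_mul, map_add, map_mul, h1, hσ3, map_ofNat, map_one, map_neg, hτδ] at h
      exact (neg_injective h).symm
    · rw [hηβ, map_mul, hησ σ h1 h2, hfcfix σ hσ3]
  -- The roots of `x³ + 3x - 2`, from which `e` and `e'` are recovered as Lagrange resolvents.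
  have hx₀ := cardano hee' (by rw [he, he']; ring)
  have hx₁ := cardano (a := ω * e) (b := ω ^ 2 * e') (by linear_combination ω ^ 3 * hee' - hω3)
    (by linear_combination ω ^ 3 * he + ω ^ 6 * he' + ((1 + τ) + (ω ^ 3 + 1) * (1 - τ)) * hω3)
  have hx₂ := cardano (a := ω ^ 2 * e) (b := ω * e') (by linear_combination ω ^ 3 * hee' - hω3)
    (by linear_combination ω ^ 6 * he + ω ^ 3 * he' + ((ω ^ 3 + 1) * (1 + τ) + (1 - τ)) * hω3)
  have he3 : e = ((e + e') + ω ^ 2 * (ω * e + ω ^ 2 * e') + ω * (ω ^ 2 * e + ω * e')) / 3 := by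
    linear_combination (-e' / 3) * hω - (2 * e + ω * e') / 3 * hω3
  have he3' : e' = ((e + e') + ω * (ω * e + ω ^ 2 * e') + ω ^ 2 * (ω ^ 2 * e + ω * e')) / 3 := by
    linear_combination (-e / 3) * hω - (2 * e' + ω * e) / 3 * hω3
  intro σ hσ
  rw [mem_fixingSubgroup_K6_iff] at hσ
  have hσe (σ : GQ) (hσ : ∀ x : Ω, x ^ 3 + 3 * x - 2 = 0 → σ x = x) (h : σ ω = ω) : σ e = e := by
    rw [he3, map_div₀, map_add, map_add, map_mul, map_mul, map_pow, hσ _ hx₀, hσ _ hx₁, hσ _ hx₂, h,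
      map_ofNat]
  have h2 : s (σ ^ 2) = 1 := by
    have hω2 := sq_apply_primitive_cubeRoot σ hω
    refine hker _ hω2 (hσe _ (fun x hx => ?_) hω2)
    rw [pow_two, AlgEquiv.mul_apply, hσ x hx, hσ x hx]
  rw [map_pow] at h2
  refine perm3_eq_one_of_sign_of_sq _ (hsign1 σ ?_) h2
  rcases algEquiv_primitive_cubeRoot σ hω with h | h
  · have h1 := hσe σ hσ h
    have h3 := congrArg σ he
    have h4 := congrArg σ hτδ
    rw [map_pow, h1, he, map_add, map_one] at h3
    rw [map_mul, map_add, map_mul, h, ← add_left_cancel h3, map_ofNat, map_one, map_neg, hτδ] at h4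
    exact (neg_injective h4).symm
  · have h1 : σ e = e' := by
      rw [he3, map_div₀, map_add, map_add, map_mul, map_mul, map_pow, hσ _ hx₀, hσ _ hx₁, hσ _ hx₂,
        h, map_ofNat, sq_primitive_cubeRoot hω]
      linear_combination -he3'
    have h3 := congrArg σ he
    have h4 := congrArg σ hτδ
    rw [map_pow, h1, he', map_add, map_one] at h3
    rw [map_mul, map_add, map_mul, h, map_ofNat, map_one, map_neg] at h4
    linear_combination (2 * ω ^ 2 + 1) * h3 + h4 - hτδ + 2 * τ * hω

/-! ### Representations matching the table -/

/-- A homomorphism from the absolute Galois group to `S₃` that is unramified outside `6` and takes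
Frobenius elements at `5`, `7` to three-cycles and those at `13` to elements with a fixed point is
surjective and factors through `Gal(K6/ℚ)`. -/
theorem surjective_and_fixingSubgroup_K6_le_ker (s : GQ →* Equiv.Perm (Fin 3))
    (hs : IsOpen (s.ker : Set GQ))
    (hur : ∀ p : ℕ, p.Prime → p ≠ 2 → p ≠ 3 → ∀ P : Ideal (𝓞 Ω), P.IsPrime →
      P.LiesOver (Ideal.span {(p : ℤ)}) → P.inertia GQ ≤ s.ker)
    (h5 : ∀ P : Ideal (𝓞 Ω), P.IsPrime → P.LiesOver (Ideal.span {((5 : ℕ) : ℤ)}) →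
      ∀ σ : GQ, IsArithFrobAt ℤ σ P → ∀ i, s σ i ≠ i)
    (h7 : ∀ P : Ideal (𝓞 Ω), P.IsPrime → P.LiesOver (Ideal.span {((7 : ℕ) : ℤ)}) →
      ∀ σ : GQ, IsArithFrobAt ℤ σ P → ∀ i, s σ i ≠ i)
    (h13 : ∀ P : Ideal (𝓞 Ω), P.IsPrime → P.LiesOver (Ideal.span {((13 : ℕ) : ℤ)}) →
      ∀ σ : GQ, IsArithFrobAt ℤ σ P → ∃ i, s σ i = i) :
    Function.Surjective s ∧ K6.fixingSubgroup ≤ s.ker := by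
  have : Fact (Nat.Prime 5) := ⟨by norm_num⟩
  have : Fact (Nat.Prime 7) := ⟨by norm_num⟩
  obtain ⟨P, hP, hP5⟩ := exists_liesOver 5
  obtain ⟨Q, hQ, hQ7⟩ := exists_liesOver 7
  obtain ⟨γ, hγ5⟩ := exists_isArithFrobAt (p := 5) P
  obtain ⟨γ', hγ7⟩ := exists_isArithFrobAt (p := 7) Q
  have hγ := h5 P hP hP5 γ hγ5
  have hγ' := h7 Q hQ hQ7 γ' hγ7
  obtain ⟨θ, hinj, hθ⟩ := exists_equivariant s hs hγ
  -- A rational multiple of the root of the discriminant is the square root of a squarefree `d`.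
  set δ₀ : Ω := (θ 0 - θ 1) * (θ 1 - θ 2) * (θ 2 - θ 0) with hδ₀
  have hδ₀0 : δ₀ ≠ 0 := by
    refine mul_ne_zero (mul_ne_zero ?_ ?_) ?_ <;>
      exact sub_ne_zero.2 (hinj.ne (by decide))
  have hsign₀ (σ : GQ) : σ δ₀ = ((Equiv.Perm.sign (s σ) : ℤ) : Ω) * δ₀ := by
    rw [hδ₀, ← prod_sub_perm θ (s σ)]
    simp only [map_mul, map_sub, hθ]
  obtain ⟨q, hq⟩ := exists_rat_of_forall_fixed (δ₀ ^ 2) fun σ => by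
    rw [map_pow, hsign₀, mul_pow]
    rcases Int.units_eq_one_or (Equiv.Perm.sign (s σ)) with h | h <;> simp [h]
  have hq0 : q ≠ 0 := by
    rintro rfl
    exact pow_ne_zero 2 hδ₀0 (by rw [← hq, Rat.cast_zero])
  obtain ⟨d, t, hd, ht, hqd⟩ := Rat.exists_squarefree_mul_sq q hq0
  have ht' : (t : Ω) ≠ 0 := by exact_mod_cast ht
  set δ : Ω := δ₀ / t with hδ
  have hδ0 : δ ≠ 0 := div_ne_zero hδ₀0 ht'
  have hδ2 : δ ^ 2 = (d : Ω) := by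
    rw [hδ, div_pow, ← hq, hqd]
    push_cast
    field_simp
  have hsign (σ : GQ) : σ δ = ((Equiv.Perm.sign (s σ) : ℤ) : Ω) * δ := by
    rw [hδ, map_div₀, hsign₀, map_ratCast, mul_div_assoc]
  obtain ⟨ω, hω⟩ := exists_primitive_cubeRoot
  obtain ⟨M, _, _, hM, hmem⟩ := exists_unramified_field s hs hur hω
  have hd6 : d.natAbs ∣ 6 := natAbs_dvd_six hM hd hδ2 <| hmem δ fun σ hσ _ => by
    rw [hsign, MonoidHom.mem_ker.1 hσ]; simp
  have hd5 : (5 : ℤ) ∣ d * (d ^ 2 - 1) := by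
    refine dvd_of_frob_fixes hγ5 hδ2 ?_ rfl
    rw [hsign, (perm3_sign_eq_one_of_forall_ne _ hγ).1]; simp
  have hd7 : (7 : ℤ) ∣ d * (d ^ 3 - 1) := by
    refine dvd_of_frob_fixes hγ7 hδ2 ?_ rfl
    rw [hsign, (perm3_sign_eq_one_of_forall_ne _ hγ').1]; simp
  have hodd : ∃ σ, Equiv.Perm.sign (s σ) = -1 := by
    by_contra! h
    exact not_forall_sign_eq_one s hs hur hγ h13 fun σ =>
      (Int.units_eq_one_or _).resolve_right (h σ)
  obtain ⟨τ, hτ⟩ := hodd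
  refine ⟨fun x => ?_, ?_⟩
  · obtain ⟨i, j, rfl⟩ := perm3_exists_pow_mul_pow _ _ hγ hτ x
    exact ⟨γ ^ i.val * τ ^ j.val, by simp⟩
  · rcases cases_of_dvd_six hd6 hd5 hd7 with rfl | rfl
    · -- A square root of `1` is rational, hence fixed by the odd element `τ`.
      have h1 : τ δ = δ := by
        rcases sq_eq_one_iff.1 (hδ2.trans Int.cast_one) with h | h <;> simp [h]
      rw [hsign, hτ] at h1
      push_cast at h1
      exact absurd (by linear_combination -h1 / 2) hδ0
    · exact fixingSubgroup_K6_le_ker s hs hur hγ (by simpa using hδ2) hsign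

theorem map_tableH5 (ε : ℤˣ) : (tableH5 ε).map redModOneAddA = X ^ 2 + X + 1 := by
  have h1 : redModOneAddA (((ε : ℤ) : GaussianInt) * 3 * gaussA) = 1 := by
    rcases Int.units_eq_one_or ε with rfl | rfl <;>
      simp [redModOneAddA, Zsqrtd.lift, gaussA] <;> decide
  have h2 : (25 : (ZMod 2)[X]) = 1 := by
    rw [← map_ofNat C 25, show (OfNat.ofNat 25 : ZMod 2) = 1 by decide, C_1]
  have h3 : (-1 : (ZMod 2)[X]) = 1 := by
    rw [← C_1, ← C_neg, show (-1 : ZMod 2) = 1 by decide]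
  rw [tableH5, Polynomial.map_sub, Polynomial.map_add, Polynomial.map_mul, map_C, h1,
    Polynomial.map_pow, map_X, Polynomial.map_ofNat, h2, C_1, one_mul, sub_eq_add_neg, h3]

theorem map_tableH7 : tableH7.map redModOneAddA = X ^ 2 + X + 1 := by
  have h2 : (2 : (ZMod 2)[X]) = 0 := CharTwo.two_eq_zero
  simp only [tableH7, Polynomial.map_sub, Polynomial.map_add, Polynomial.map_mul,
    Polynomial.map_pow, map_X, Polynomial.map_ofNat]
  linear_combination (24 - 3 * X : (ZMod 2)[X]) * h2

theorem map_tableH13 : tableH13.map redModOneAddA = X ^ 2 + 1 := by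
  have h2 : (2 : (ZMod 2)[X]) = 0 := CharTwo.two_eq_zero
  simp only [tableH13, Polynomial.map_add, Polynomial.map_mul,
    Polynomial.map_pow, map_X, Polynomial.map_ofNat]
  linear_combination (84 + 5 * X : (ZMod 2)[X]) * h2

theorem GQRep.isOpen_ker (ρ : GQRep) : IsOpen (ρ.toMonoidHom.ker : Set GQ) := by
  have : (ρ.toMonoidHom.ker : Set GQ) = ρ ⁻¹' {1} := by
    ext; simp [MonoidHom.mem_ker]
  rw [this]
  exact (isOpen_discrete _).preimage ρ.continuous_toFun

/-- A representation matching the table is surjective and factors through `Gal(K6/ℚ)`. -/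
theorem GQRep.MatchesTable.surjective_and_fixingSubgroup_K6_le_ker {ρ : GQRep} {ε : ℤˣ}
    (h : ρ.MatchesTable ε) :
    Function.Surjective ρ ∧ K6.fixingSubgroup ≤ ρ.toMonoidHom.ker := by
  let s : GQ →* Equiv.Perm (Fin 3) := glPerm.toMonoidHom.comp ρ.toMonoidHom
  have hker : s.ker = ρ.toMonoidHom.ker := by
    ext σ
    exact glPerm.map_eq_one_iff
  obtain ⟨h1, h2⟩ := _root_.surjective_and_fixingSubgroup_K6_le_ker s
    (hker ▸ ρ.isOpen_ker)
    (fun p hp hp2 hp3 P hP hPp σ hσ => hker ▸ h.unramified p hp hp2 hp3 P hP hPp σ hσ)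
    (fun P hP hPp σ hσ => (charpoly_eq_add_add_iff_glPerm _).1
      ((h.frob5 P hP hPp σ hσ).trans (map_tableH5 ε)))
    (fun P hP hPp σ hσ => (charpoly_eq_add_add_iff_glPerm _).1
      ((h.frob7 P hP hPp σ hσ).trans map_tableH7))
    (fun P hP hPp σ hσ => (charpoly_eq_add_iff_glPerm _).1
      ((h.frob13 P hP hPp σ hσ).trans map_tableH13))
  refine ⟨fun g => ?_, hker ▸ h2⟩
  obtain ⟨σ, hσ⟩ := h1 (glPerm g)
  exact ⟨σ, glPerm.injective hσ⟩

/-! ### The representation on the roots of `x³ + 3x - 2` -/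

/-- The roots of `x³ + 3x - 2` in `ℚ̄`, as elements of the ring of all algebraic integers. -/
def CubicRoot : Type := {x : 𝓞 Ω // x ^ 3 + 3 * x - 2 = 0}

theorem isIntegral_of_cubic {x : Ω} (hx : x ^ 3 + 3 * x - 2 = 0) : IsIntegral ℤ x :=
  ⟨X ^ 3 + 3 * X - 2, by monicity!, by simpa using hx⟩

theorem coe_cubic_eq_zero_iff {x : 𝓞 Ω} :
    algebraMap (𝓞 Ω) Ω x ^ 3 + 3 * algebraMap (𝓞 Ω) Ω x - 2 = 0 ↔ x ^ 3 + 3 * x - 2 = 0 := by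
  rw [← RingOfIntegers.coe_injective.eq_iff, map_sub, map_add, map_mul, map_pow,
    map_ofNat (algebraMap (𝓞 Ω) Ω) 3, map_ofNat (algebraMap (𝓞 Ω) Ω) 2, map_zero]

noncomputable instance : MulAction GQ CubicRoot where
  smul σ x := ⟨σ • x.1, by
    have := congrArg σ (coe_cubic_eq_zero_iff.2 x.2)
    rw [← coe_cubic_eq_zero_iff, coe_smul_ringOfIntegers]
    rwa [map_sub, map_add, map_mul, map_pow, map_ofNat σ 3, map_ofNat σ 2, map_zero] at this⟩
  one_smul x := Subtype.ext (one_smul GQ x.1)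
  mul_smul σ τ x := Subtype.ext (mul_smul σ τ x.1)

theorem card_cubicRoot : Nat.card CubicRoot = 3 := by
  have e : CubicRoot ≃ (X ^ 3 + 3 * X - 2 : ℚ[X]).rootSet Ω :=
    { toFun := fun x => ⟨x.1, mem_rootSet_iff.2 (coe_cubic_eq_zero_iff.2 x.2)⟩
      invFun := fun x => ⟨⟨x.1, isIntegral_of_cubic (mem_rootSet_iff.1 x.2)⟩,
        coe_cubic_eq_zero_iff.1 (mem_rootSet_iff.1 x.2)⟩
      left_inv := fun x => rfl
      right_inv := fun x => rfl }
  rw [Nat.card_congr e, Nat.card_eq_fintype_card, card_rootSet_eq_natDegree]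
  · compute_degree!
  · have h : (C (1 / 12) : ℚ[X]) * 12 = 1 := by
      rw [← map_ofNat C 12, ← C_mul]; norm_num
    refine ⟨C (1 / 12) * (-3 * X - 3), C (1 / 12) * (X ^ 2 + X + 2), ?_⟩
    simp only [derivative_sub, derivative_add, derivative_mul, derivative_X_pow, derivative_X,
      derivative_ofNat]
    simp only [Nat.cast_ofNat, map_ofNat]
    linear_combination h
  · exact IsAlgClosed.splits _

/-- Distinct roots of `x³ + 3x - 2`, a polynomial of discriminant `-216`, stay distinct modulo
primes not above `6`. -/
theorem CubicRoot.eq_of_sub_mem {p : ℕ} [hp : Fact p.Prime] (hp2 : p ≠ 2) (hp3 : p ≠ 3)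
    {P : Ideal (𝓞 Ω)} [P.IsPrime] [P.LiesOver (Ideal.span {(p : ℤ)})] {x y : CubicRoot}
    (h : x.1 - y.1 ∈ P) : x = y := by
  by_contra hne
  have hne' : x.1 - y.1 ≠ 0 := sub_ne_zero.2 fun h => hne (Subtype.ext h)
  -- Modulo `P` both `f(x)` and `f'(x)` vanish, where `f = x³ + 3x - 2`, and `12` lies in `(f, f')`.
  have h1 : x.1 ^ 2 + x.1 * y.1 + y.1 ^ 2 + 3 = 0 :=
    mul_left_cancel₀ hne' (by linear_combination x.2 - y.2)
  have h2 : ((12 : ℤ) : 𝓞 Ω) ∈ P := by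
    convert P.mul_mem_right ((2 * x.1 + y.1) * (x.1 ^ 2 + x.1 + 2)) h using 1
    push_cast
    linear_combination (-3 * x.1 - 3) * x.2 + (x.1 ^ 2 + x.1 + 2) * h1
  rw [intCast_mem_iff_of_liesOver (p := p)] at h2
  have h3 : p ∣ 2 ^ 2 * 3 := by exact_mod_cast h2
  rcases (Nat.Prime.dvd_mul hp.out).1 h3 with h4 | h4
  · exact hp2 ((Nat.prime_dvd_prime_iff_eq hp.out Nat.prime_two).1 (hp.out.dvd_of_dvd_pow h4))
  · exact hp3 ((Nat.prime_dvd_prime_iff_eq hp.out Nat.prime_three).1 h4)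

/-- `x³ + 3x - 2` has no root modulo `5`, as the ideal of `ℤ[x]` that it generates
together with `x⁵ - x` contains `24`. -/
theorem CubicRoot.frob_five_ne {P : Ideal (𝓞 Ω)} [P.IsPrime]
    [P.LiesOver (Ideal.span {((5 : ℕ) : ℤ)})] {σ : GQ} (hσ : IsArithFrobAt ℤ σ P)
    (x : CubicRoot) : σ • x ≠ x := by
  intro h
  have h1 := (isArithFrobAt_iff (p := 5)).1 hσ x.1
  rw [show σ • x.1 = x.1 from congrArg Subtype.val h] at h1
  -- An explicit Bézout identity.
  have h2 : ((24 : ℤ) : 𝓞 Ω) ∈ P := by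
    convert P.mul_mem_left (38 + 7 * x.1 + 11 * x.1 ^ 2) h1 using 1
    push_cast
    linear_combination (-12 + x.1 + 5 * x.1 ^ 2 + 7 * x.1 ^ 3 + 11 * x.1 ^ 4) * x.2
  rw [intCast_mem_iff_of_liesOver (p := 5)] at h2
  revert h2; decide

/-- `x³ + 3x - 2` has no root modulo `7`, as the ideal of `ℤ[x]` that it generates
together with `x⁷ - x` contains `78`. -/
theorem CubicRoot.frob_seven_ne {P : Ideal (𝓞 Ω)} [P.IsPrime]
    [P.LiesOver (Ideal.span {((7 : ℕ) : ℤ)})] {σ : GQ} (hσ : IsArithFrobAt ℤ σ P)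
    (x : CubicRoot) : σ • x ≠ x := by
  intro h
  have h1 := (isArithFrobAt_iff (p := 7)).1 hσ x.1
  rw [show σ • x.1 = x.1 from congrArg Subtype.val h] at h1
  -- An explicit Bézout identity.
  have h2 : ((78 : ℤ) : 𝓞 Ω) ∈ P := by
    convert P.mul_mem_left (113 + 20 * x.1 + 34 * x.1 ^ 2) h1 using 1
    push_cast
    linear_combination (-39 - 2 * x.1 + 7 * x.1 ^ 2 + 8 * x.1 ^ 3 + 11 * x.1 ^ 4 + 20 * x.1 ^ 5
      + 34 * x.1 ^ 6) * x.2
  rw [intCast_mem_iff_of_liesOver (p := 7)] at h2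
  revert h2; decide

theorem CubicRoot.exists_frob_thirteen_eq {P : Ideal (𝓞 Ω)} [P.IsPrime]
    [P.LiesOver (Ideal.span {((13 : ℕ) : ℤ)})] {σ : GQ} (hσ : IsArithFrobAt ℤ σ P) :
    ∃ x : CubicRoot, σ • x = x := by
  have : Fact (Nat.Prime 13) := ⟨by norm_num⟩
  have hfrob := (isArithFrobAt_iff (p := 13)).1 hσ
  have h13 : ((13 : ℕ) : 𝓞 Ω) ∈ P := natCast_mem_of_liesOver
  -- `9` is a root modulo `13`, so some root is congruent to `9`, hence to its own Frobenius image.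
  obtain ⟨r, hr⟩ : ∃ r : CubicRoot, 9 - r.1 ∈ P := by
    have : Nontrivial CubicRoot := by
      have : Finite CubicRoot := Nat.finite_of_card_ne_zero (by rw [card_cubicRoot]; norm_num)
      exact Finite.one_lt_card_iff_nontrivial.1 (by rw [card_cubicRoot]; norm_num)
    obtain ⟨x, y, hxy⟩ := exists_pair_ne CubicRoot
    have hne' : x.1 - y.1 ≠ 0 := sub_ne_zero.2 fun h => hxy (Subtype.ext h)
    have h1 : x.1 ^ 2 + x.1 * y.1 + y.1 ^ 2 + 3 = 0 :=
      mul_left_cancel₀ hne' (by linear_combination x.2 - y.2)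
    -- The third root; `(9 - x) * (9 - y) * (9 - z)` is the value `754 = 58 * 13` at `9`.
    let z : CubicRoot := ⟨-x.1 - y.1, by
      linear_combination x.2 - (2 * x.1 + y.1) * h1⟩
    have h2 : (9 - x.1) * (9 - y.1) * (9 - z.1) ∈ P := by
      convert P.mul_mem_left 58 h13 using 1
      change (9 - x.1) * (9 - y.1) * (9 - (-x.1 - y.1)) = _
      push_cast
      linear_combination (-9 + x.1) * h1 - x.2
    rcases Ideal.IsPrime.mem_or_mem ‹_› h2 with h2 | h2
    · rcases Ideal.IsPrime.mem_or_mem ‹_› h2 with h2 | h2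
      exacts [⟨x, h2⟩, ⟨y, h2⟩]
    · exact ⟨z, h2⟩
  refine ⟨r, eq_of_sub_mem (p := 13) (P := P) (by norm_num) (by norm_num) ?_⟩
  have h9 : (9 : 𝓞 Ω) ^ 13 - 9 ∈ P := by
    convert P.mul_mem_left (((9 ^ 13 - 9) / 13 : ℕ) : 𝓞 Ω) h13 using 1
    norm_num
  have hpow : (9 : 𝓞 Ω) ^ 13 - r.1 ^ 13 ∈ P := Ideal.mem_of_dvd P (sub_dvd_pow_sub_pow _ _ 13) hr
  convert P.add_mem (P.sub_mem (hfrob r.1) hpow) (P.add_mem h9 hr) using 1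
  change σ • r.1 - r.1 = _
  ring

/-- The representation on the roots of `x³ + 3x - 2` matches the table: here `GL₂(𝔽₂)` is the
symmetric group of these roots. -/
theorem exists_matchesTable (ε : ℤˣ) :
    ∃ ρ : GQRep, ρ.MatchesTable ε ∧ ρ.toMonoidHom.ker = K6.fixingSubgroup := by
  have hfin : Finite CubicRoot := Nat.finite_of_card_ne_zero (by rw [card_cubicRoot]; norm_num)
  let e : CubicRoot ≃ Fin 3 := Finite.equivFinOfCardEq card_cubicRoot
  let s : GQ →* Equiv.Perm (Fin 3) :=
    (Equiv.permCongrHom e).toMonoidHom.comp (MulAction.toPermHom GQ CubicRoot)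
  have hs (σ : GQ) (i : Fin 3) : s σ i = e (σ • e.symm i) := rfl
  have hs' (σ : GQ) (x : CubicRoot) : s σ (e x) = e (σ • x) := by rw [hs, e.symm_apply_apply]
  let r : GQ →* GL (Fin 2) (ZMod 2) := glPerm.symm.toMonoidHom.comp s
  have hr (σ : GQ) : glPerm (r σ) = s σ := glPerm.apply_symm_apply _
  have hr1 (σ : GQ) : r σ = 1 ↔ ∀ x : CubicRoot, σ • x = x := by
    rw [← glPerm.map_eq_one_iff, hr, Equiv.ext_iff, e.symm.forall_congr_left]
    simp [hs']
  have hker : r.ker = K6.fixingSubgroup := by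
    ext σ
    rw [MonoidHom.mem_ker, hr1, mem_fixingSubgroup_K6_iff]
    refine ⟨fun h x hx => ?_, fun h x => Subtype.ext (RingOfIntegers.coe_injective (h x.1 ?_))⟩
    · exact congrArg (fun y : CubicRoot => algebraMap (𝓞 Ω) Ω y.1)
        (h ⟨⟨x, isIntegral_of_cubic hx⟩, coe_cubic_eq_zero_iff.1 hx⟩)
    · exact coe_cubic_eq_zero_iff.2 x.2
  have hopen : IsOpen (r.ker : Set GQ) := by
    rw [hker]
    have : Finite ((X ^ 3 + 3 * X - 2 : ℚ[X]).rootSet Ω) := (rootSet_finite _ _).to_subtype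
    have : FiniteDimensional ℚ K6 := IntermediateField.finiteDimensional_adjoin fun x _ =>
      (AlgebraicClosure.isAlgebraic ℚ).isAlgebraic x |>.isIntegral
    exact K6.fixingSubgroup_isOpen
  have hcont : Continuous r := by
    refine continuous_of_continuousAt_one r ?_
    rw [ContinuousAt, nhds_discrete (GL (Fin 2) (ZMod 2)), map_one]
    exact Filter.tendsto_pure.2 (hopen.mem_nhds r.ker.one_mem)
  refine ⟨⟨r, hcont⟩, ⟨fun p hp hp2 hp3 P hP hPp σ hσ => ?_, fun P hP hPp σ hσ => ?_,
    fun P hP hPp σ hσ => ?_, fun P hP hPp σ hσ => ?_⟩, hker⟩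
  · have : Fact p.Prime := ⟨hp⟩
    exact (hr1 σ).2 fun x => CubicRoot.eq_of_sub_mem (p := p) (P := P) hp2 hp3 (hσ x.1)
  · rw [map_tableH5]
    refine (charpoly_eq_add_add_iff_glPerm _).2 fun i hi => ?_
    obtain ⟨x, rfl⟩ := e.surjective i
    exact CubicRoot.frob_five_ne hσ x (e.injective ((hs' σ x).symm.trans (hr σ ▸ hi)))
  · rw [map_tableH7]
    refine (charpoly_eq_add_add_iff_glPerm _).2 fun i hi => ?_
    obtain ⟨x, rfl⟩ := e.surjective i
    exact CubicRoot.frob_seven_ne hσ x (e.injective ((hs' σ x).symm.trans (hr σ ▸ hi)))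
  · rw [map_tableH13]
    obtain ⟨x, hx⟩ := CubicRoot.exists_frob_thirteen_eq hσ
    exact (charpoly_eq_add_iff_glPerm _).2 ⟨e x, by
      change glPerm (r σ) (e x) = _
      rw [hr, hs', hx]⟩

theorem Group.exists_mulEquiv_of_ker_eq {G H : Type*} [Group G] [Group H] {f g : G →* H}
    (hf : Function.Surjective f) (hg : Function.Surjective g) (h : f.ker = g.ker) :
    ∃ ψ : H ≃* H, ∀ x, g x = ψ (f x) := by
  let a := QuotientGroup.quotientKerEquivOfSurjective f hf
  let b := QuotientGroup.quotientKerEquivOfSurjective g hg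
  refine ⟨(a.symm.trans (QuotientGroup.quotientMulEquivOfEq h)).trans b, fun x => ?_⟩
  have : a.symm (f x) = (x : G ⧸ f.ker) := a.injective (by rw [a.apply_symm_apply]; rfl)
  simp [this]
  rfl

theorem ker_eq_of_surjective_of_le {G H : Type*} [Group G] [Group H] [Finite H] {f g : G →* H}
    (hf : Function.Surjective f) (hg : Function.Surjective g) (h : f.ker ≤ g.ker) :
    f.ker = g.ker := by
  have hindex {k : G →* H} (hk : Function.Surjective k) : k.ker.index = Nat.card H := by
    rw [Subgroup.index_ker, MonoidHom.range_eq_top.2 hk, Subgroup.card_top]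
  have h1 := Subgroup.relIndex_mul_index h
  rw [hindex hf, hindex hg] at h1
  exact h.antisymm (Subgroup.relIndex_eq_one.1
    (Nat.eq_of_mul_eq_mul_right Nat.card_pos (by rw [h1, one_mul])))

theorem lemma6p1 (ε : ℤˣ) :
    (∃ ρ : GQRep, ρ.MatchesTable ε) ∧
    (∀ ρ ρ' : GQRep, ρ.MatchesTable ε → ρ'.MatchesTable ε → ρ.Isomorphic ρ') ∧
    (∀ ρ : GQRep, ρ.MatchesTable ε →
      Function.Surjective ρ ∧ ρ.toMonoidHom.ker = K6.fixingSubgroup) := by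
  obtain ⟨ρ₀, h₀, hker₀⟩ := exists_matchesTable ε
  have key (ρ : GQRep) (h : ρ.MatchesTable ε) :
      Function.Surjective ρ ∧ ρ.toMonoidHom.ker = K6.fixingSubgroup := by
    obtain ⟨h1, h2⟩ := h.surjective_and_fixingSubgroup_K6_le_ker
    rw [← hker₀] at h2 ⊢
    exact ⟨h1, (ker_eq_of_surjective_of_le
      h₀.surjective_and_fixingSubgroup_K6_le_ker.1 h1 h2).symm⟩
  refine ⟨⟨ρ₀, h₀⟩, fun ρ ρ' h h' => ?_, key⟩
  obtain ⟨hsurj, hker⟩ := key ρ h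
  obtain ⟨hsurj', hker'⟩ := key ρ' h'
  obtain ⟨ψ, hψ⟩ := Group.exists_mulEquiv_of_ker_eq (f := ρ.toMonoidHom) (g := ρ'.toMonoidHom)
    hsurj hsurj' (hker.trans hker'.symm)
  obtain ⟨g, hg⟩ := gl_mulAut_inner ψ
  exact ⟨g, fun σ => (hψ σ).trans (hg _)⟩
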